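/- Let $X\subset A^{\mathbb Z}$ be an infinite minimal subshift over a finite alphabet $A$, let $p(q)$ be the number of words of length $q$ occurring in points of $X$, and suppose $\limsup_{q\to\infty} p(q)/q<3/2$. Write $|w|$ for the length of a word $w$. Then there exist $\nu>0$ and nonempty words $u_k,v_k$ ($k\ge 0$) such that $v_k^\infty$ and $v_k^\infty u_k$ (read as left-infinite words) have a longest common suffix $s_k$, and, writing $p_k$ for the longest common prefix of $u_k$ and $v_k$, the following hold. 1. For every $k$, every $x\in X$ can be decomposed in exactly one way as a bi-infinite concatenation of the words $v_k$ and $u_k$. 2. For every $k$, $|v_k|<|u_k|$ and $v_k$ is a suffix of $u_k$. 3. For every $k$, $|p_k|+|s_k|<|v_k|+|u_k|$. 4. For every $k\ge1$, $|p_k|+|s_k|<2|v_k|+|v_{k-1}|<3|v_k|$. 5. $p(q)<(3/2-\nu)q$ for all integers $q\ge|v_0|$. 6. For every $k$, exactly one of the following holds: (a) there are positive integers $m_k<n_k$ with $v_{k+1}=v_k^{m_k-1}u_k$ and $u_{k+1}=v_k^{n_k-1}u_k$; (b) there are positive integers $r_k<m_k<n_k$ with $v_{k+1}=v_k^{m_k-1}u_kv_k^{r_k-1}u_k$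 and $u_{k+1}=v_k^{n_k-1}u_kv_k^{r_k-1}u_k$. 7. ($S$-adic form.) For integers $0\le r<m<n$ let $\tau_{m,n,r}$ be the substitution on $\{0,1\}$ given by $0\mapsto 0^{m-1}1,\ 1\mapsto 0^{n-m}0^{m-1}1$ if $r=0$, and $0\mapsto 0^{m-1}10^{r-1}1,\ 1\mapsto 0^{n-m}0^{m-1}10^{r-1}1$ if $r>0$. There are a substitution $\pi$ from $\{0,1\}$ to words over $A$ and integers $0\le r_k<m_k<n_k$ ($k\ge0$) such that, with $\xi_k=\pi\circ\tau_{m_0,n_0,r_0}\circ\cdots\circ\tau_{m_{k-1},n_{k-1},r_{k-1}}$ (so $\xi_0=\pi$), one has $v_k=\xi_k(0)$ and $u_k=\xi_k(1)$ for all $k$. The words $\xi_k(0)$ converge to a left-infinite word whose orbit closure is $X$. Moreover there is a right-infinite word $y$ whose orbit closure is $X$ such that every prefix of $y$ is a prefix of $\xi_k(0)$ for infinitely many $k$; if $m_k\ge2$ for infinitely many $k$, then every prefix of $y$ is a prefix of $\xi_k(0)$ for all sufficiently large $k$, i.e. $y=\lim_k\xi_k(0)$. Here the orbit closure of a one-sided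 infinite word is the two-sided subshift of all $x\in A^{\mathbb Z}$ all of whose finite subwords occur in that word. -/

import Mathlib

namespace LowComplexity

open Filter SymbolicDynamics.FullShift

/-- The word `x_i x_{i+1} ... x_{i+n-1}` read in a bi-infinite sequence. -/
def block {A : Type*} (x : ℤ → A) (i : ℤ) (n : ℕ) : List A :=
  List.ofFn fun j : Fin n => x (i + (j : ℤ))

/-- `L_q(X)`: the words of length `q` that appear in points of `X`. -/
def languageOfLength {A : Type*} (X : Set (ℤ → A)) (q : ℕ) : Set (List A) :=
  {w | ∃ x ∈ X, ∃ i : ℤ, w = block x i q}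

/-- The word complexity function `p(q) = |L_q(X)|`. -/
noncomputable def complexity {A : Type*} (X : Set (ℤ → A)) (q : ℕ) : ℕ :=
  (languageOfLength X q).ncard

/-- A (nonempty) subshift is minimal if it properly contains no nonempty subshift. -/
def IsMinimalSubshift {A : Type*} [TopologicalSpace A] (X : Subshift A ℤ) : Prop :=
  X.carrier.Nonempty ∧
    ∀ Y : Subshift A ℤ, Y.carrier.Nonempty → Y.carrier ⊆ X.carrier → Y.carrier = X.carrier

/-- The power `w^n` of a word. -/
def wpow {A : Type*} (w : List A) (n : ℕ) : List A := (List.replicate n w).flatten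

/-- `p` is the maximal common prefix of the words `u` and `v`. -/
def IsMaxCommonPrefix {A : Type*} (u v p : List A) : Prop :=
  p <+: u ∧ p <+: v ∧ ∀ w : List A, w <+: u → w <+: v → w <+: p

/-- The finite word `w` is a suffix of the left-infinite word `v^∞ t`
(`t` a finite word). -/
def IsSuffixOfInfPow {A : Type*} (v t w : List A) : Prop :=
  ∃ N : ℕ, w <:+ wpow v N ++ t

/-- `s` is the maximal common suffix of the left-infinite words `v^∞` and `v^∞ u`; in
particular the common suffixes have bounded length, so that there is a longest one. -/
def IsMaxCommonSuffix {A : Type*} (v u s : List A) : Prop :=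
  IsSuffixOfInfPow v [] s ∧ IsSuffixOfInfPow v u s ∧
    ∀ w : List A, IsSuffixOfInfPow v [] w → IsSuffixOfInfPow v u w → w <:+ s

/-- A decomposition of `x` as a bi-infinite concatenation of the words `v` and `u`: the `i`-th
word is `d.2 i`, and it occupies the positions from `d.1 i` to `d.1 (i + 1) - 1`. The indexing is
normalized so that the word with index `0` covers the position `0`; hence two decompositions in
this sense are equal exactly if they cut `x` at the same places into the same words. -/
def IsDecomposition {A : Type*} (v u : List A) (x : ℤ → A) (d : (ℤ → ℤ) × (ℤ → List A)) : Prop :=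
  d.1 0 ≤ 0 ∧ 0 < d.1 1 ∧
    ∀ i : ℤ, (d.2 i = v ∨ d.2 i = u) ∧ d.1 (i + 1) = d.1 i + ((d.2 i).length : ℤ) ∧
      block x (d.1 i) (d.2 i).length = d.2 i

/-- The substitution `τ_{m,n,r}` on the alphabet `{0, 1}`, for `0 ≤ r < m < n`. -/
def tau (m n r : ℕ) : Fin 2 → List (Fin 2) := fun a =>
  List.replicate (if a = 0 then 0 else n - m) 0 ++ List.replicate (m - 1) 0 ++ [1] ++
    (if r = 0 then [] else List.replicate (r - 1) 0 ++ [1])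

/-- Composition `θ ∘ τ` of substitutions, `θ` being extended to words by concatenation. -/
def substComp {α β γ : Type*} (θ : β → List γ) (τ : α → List β) : α → List γ :=
  fun a => (τ a).flatMap θ

/-- `xi π m n r k = π ∘ τ_{m_0,n_0,r_0} ∘ ⋯ ∘ τ_{m_{k-1},n_{k-1},r_{k-1}}`. -/
def xi {A : Type*} (π : Fin 2 → List A) (m n r : ℕ → ℕ) : ℕ → Fin 2 → List A
  | 0 => π
  | k + 1 => substComp (xi π m n r k) (tau (m k) (n k) (r k))

/-- The word `y_i y_{i+1} ... y_{i+N-1}` read in a right-infinite word `y = y_0 y_1 y_2 ...`. -/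
def rightBlock {A : Type*} (y : ℕ → A) (i N : ℕ) : List A :=
  List.ofFn fun j : Fin N => y (i + j)

/-- The word `z_{i+N-1} ... z_{i+1} z_i` read in a left-infinite word `z = ... z_2 z_1 z_0`. -/
def leftBlock {A : Type*} (z : ℕ → A) (i N : ℕ) : List A :=
  (List.ofFn fun j : Fin N => z (i + j)).reverse

/-- The two-sided subshift of all `x` whose finite subwords all occur in the right-infinite word
`y`. It is the natural extension of the closure of the orbit of `y` under the shift. -/
def rightOrbitClosure {A : Type*} (y : ℕ → A) : Set (ℤ → A) :=
  {x | ∀ (i : ℤ) (N : ℕ), ∃ j : ℕ, block x i N = rightBlock y j N}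

/-- The same for a left-infinite word `z`. -/
def leftOrbitClosure {A : Type*} (z : ℕ → A) : Set (ℤ → A) :=
  {x | ∀ (i : ℤ) (N : ℕ), ∃ j : ℕ, block x i N = leftBlock z j N}

/-- The right-infinite word `y` is the limit of the words `w k`: every prefix of `y` is a prefix
of `w k` for all large `k`. -/
def IsRightLimit {A : Type*} (w : ℕ → List A) (y : ℕ → A) : Prop :=
  ∀ N : ℕ, ∀ᶠ k in atTop, rightBlock y 0 N <+: w k

/-- The right-infinite word `y` is a limit along a subsequence of the words `w k`. -/
def IsRightSubseqLimit {A : Type*} (w : ℕ → List A) (y : ℕ → A) : Prop :=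
  ∀ N : ℕ, ∃ᶠ k in atTop, rightBlock y 0 N <+: w k

/-- The left-infinite word `z` is the limit of the words `w k`. -/
def IsLeftLimit {A : Type*} (w : ℕ → List A) (z : ℕ → A) : Prop :=
  ∀ N : ℕ, ∀ᶠ k in atTop, leftBlock z 0 N <:+ w k

end LowComplexity

/-! A `Level` is a pair of words v, u together with marks s, p: the points of X are concatenations
of v and u, and the boundaries are exactly the positions preceded by s and followed by p. As
boundaries are recognised locally, the decomposition is unique; as s and p cannot be prolonged, they
are the maximal common suffix and prefix. Writing 0 for v and 1 for u turns X into a binary system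
in which every right special word c yields the right special word s φ(c) p of X, where φ is `phi v
u`.

Everything rests on one count, `Level.not_special_pair`. Let two right special coded words have
maximal common suffix e. Beyond length |s|+|p|+|φ(e)| they provide two right special words of each
length, so the complexity, which is at least q+1 by aperiodicity, grows by at least 2 per step. If
both images have length at least |v|+|u|+2|φ(e)|, then |s|+|p| < |v|+|u| lets the complexity reach
3q/2, a contradiction.

This is applied to the gaps, the numbers of 0 between consecutive 1. A single gap would force
periodicity. Any gap m below another gap gives a right special word 0^r 1 0^m, r being the least
gap, and the count leaves two cases: two gaps g < h, or three gaps r < g < h with r in every second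
place (`Level.gaps_alternate`, `Level.not_four_gaps`). So the coded points are concatenations of 0^g
1 t and 0^h 1 t with t empty or 0^r 1. By `Level.derive` these code a new level, with marks s' = s
v' and p' = v^g p. This is the recursion.

The first level comes from `exists_return_words`. The complexity cannot grow by 2 at all large
lengths, so some long word w is the only right special word of its length and has two continuations,
hence two return words. Prolonging w to the left as long as its past is forced gives W = s, while p
is empty. If both return words were longer than N = |W|, their windows would be 2N+1 different words
of length N, too many.

Finally, v_k is a suffix of v_{k+1} and p_k a prefix of p_{k+1}. This produces the limits, and
minimality identifies their orbit closures. -/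

namespace LowComplexity

open Filter SymbolicDynamics.FullShift

/-! ### Occurrences of finite words in bi-infinite sequences -/

section Blocks

variable {A : Type*}

/-- The word `w` occurs in `x` at position `i`. -/
def At (x : ℤ → A) (i : ℤ) (w : List A) : Prop := block x i w.length = w

@[simp] lemma length_block (x : ℤ → A) (i : ℤ) (n : ℕ) : (block x i n).length = n := by
  simp [block]

lemma at_iff {x : ℤ → A} {i : ℤ} {w : List A} :
    At x i w ↔ ∀ k (h : k < w.length), x (i + k) = w[k] := by
  unfold At
  constructor
  · intro h k hk
    have : (block x i w.length)[k]'(by simpa using hk) = w[k] := by congr 1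
    rw [← this]; simp [block]
  · intro h
    apply List.ext_getElem (by simp)
    intro k h1 h2
    rw [← h k h2]; simp [block]

lemma block_eq_block_iff {x y : ℤ → A} {i j : ℤ} {n : ℕ} :
    block x i n = block y j n ↔ ∀ l < n, x (i + (l : ℕ)) = y (j + (l : ℕ)) := by
  unfold block
  rw [List.ofFn_inj, funext_iff]
  constructor
  · intro h l hl; exact h ⟨l, hl⟩
  · intro h l; exact h l l.2

lemma block_add (x : ℤ → A) (i : ℤ) (m n : ℕ) :
    block x i (m + n) = block x i m ++ block x (i + m) n := by
  unfold block
  rw [List.ofFn_add]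
  congr 1
  simp [add_assoc]

@[simp] lemma at_nil (x : ℤ → A) (i : ℤ) : At x i [] := by simp [At, block]

@[simp] lemma at_block (x : ℤ → A) (i : ℤ) (n : ℕ) : At x i (block x i n) := by simp [At]

@[simp] lemma at_singleton {x : ℤ → A} {i : ℤ} {a : A} : At x i [a] ↔ x i = a := by
  simp [At, block]

lemma at_append {x : ℤ → A} {i : ℤ} {w₁ w₂ : List A} :
    At x i (w₁ ++ w₂) ↔ At x i w₁ ∧ At x (i + w₁.length) w₂ := by
  unfold At
  rw [List.length_append, block_add]
  exact ⟨fun h => List.append_inj h (by simp), fun h => by rw [h.1, h.2]⟩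

lemma At.of_prefix {x : ℤ → A} {i : ℤ} {w w' : List A} (h : At x i w) (hp : w' <+: w) :
    At x i w' := by
  obtain ⟨t, rfl⟩ := hp
  exact (at_append.1 h).1

lemma At.of_suffix {x : ℤ → A} {i j : ℤ} {w w' : List A} (h : At x i w) (hp : w' <:+ w)
    (hj : j + w'.length = i + w.length) : At x j w' := by
  obtain ⟨t, rfl⟩ := hp
  have := (at_append.1 h).2
  convert this using 1
  push_cast [List.length_append] at hj
  omega

lemma At.prefix_of_le {x : ℤ → A} {i : ℤ} {w w' : List A} (h : At x i w) (h' : At x i w')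
    (hl : w.length ≤ w'.length) : w <+: w' := by
  obtain ⟨k, hk⟩ := Nat.exists_eq_add_of_le hl
  unfold At at h h'
  rw [hk, block_add, h] at h'
  exact ⟨_, h'⟩

lemma At.eq_of_length {x : ℤ → A} {i : ℤ} {w w' : List A} (h : At x i w) (h' : At x i w')
    (hl : w.length = w'.length) : w = w' := by
  unfold At at h h'
  rw [← h, ← h', hl]

lemma At.suffix_of_le {x : ℤ → A} {i j : ℤ} {w w' : List A} (h : At x i w) (h' : At x j w')
    (hij : i + w.length = j + w'.length) (hl : w.length ≤ w'.length) : w <:+ w' := by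
  have e : w' = w'.take (w'.length - w.length) ++ w'.drop (w'.length - w.length) := by simp
  rw [e] at h'
  have h2 := (at_append.1 h').2
  have : w = w'.drop (w'.length - w.length) := by
    refine At.eq_of_length h (by convert h2 using 1; simp; omega) (by simp; omega)
  rw [this]
  exact List.drop_suffix _ _

/-- The language of a set of bi-infinite sequences. -/
def Lang (X : Set (ℤ → A)) : Set (List A) := {w | ∃ x ∈ X, ∃ i : ℤ, At x i w}

lemma mem_languageOfLength {X : Set (ℤ → A)} {q : ℕ} {w : List A} :
    w ∈ languageOfLength X q ↔ w ∈ Lang X ∧ w.length = q := by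
  constructor
  · rintro ⟨x, hx, i, rfl⟩
    exact ⟨⟨x, hx, i, by simp⟩, by simp⟩
  · rintro ⟨⟨x, hx, i, h⟩, rfl⟩
    exact ⟨x, hx, i, h.symm⟩

lemma finite_languageOfLength [Finite A] (X : Set (ℤ → A)) (q : ℕ) :
    (languageOfLength X q).Finite :=
  (List.finite_length_eq A q).subset fun _ hw => (mem_languageOfLength.1 hw).2

lemma lang_of_infix {X : Set (ℤ → A)} {w w' : List A} (h : w ∈ Lang X) (hw : w' <:+: w) :
    w' ∈ Lang X := by
  obtain ⟨x, hx, i, hi⟩ := h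
  obtain ⟨a, b, rfl⟩ := hw
  exact ⟨x, hx, _, (at_append.1 (at_append.1 hi).1).2⟩

lemma block_infix_block {x : ℤ → A} {i j : ℤ} {m n : ℕ} (h1 : i ≤ j) (h2 : j + m ≤ i + n) :
    block x j m <:+: block x i n := by
  obtain ⟨a, rfl⟩ := Int.exists_add_of_le h1
  refine ⟨block x i a, block x (i + a + m) (n - a - m), ?_⟩
  rw [← block_add, show i + (a : ℤ) + m = i + ((a + m : ℕ) : ℤ) by push_cast; ring, ← block_add]
  congr 1; omega

end Blocks

/-! ### Right special words and the growth of the complexity -/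

section Counting

variable {A : Type*} [Finite A]

/-- Deleting the last letter still maps the words of length `n + 1` outside `T` onto all words of
length `n`, because each word of `T` has a sibling outside `T`. -/
lemma complexity_add_card_le {X : Set (ℤ → A)} {n : ℕ} (T : Finset (List A))
    (hT : ∀ w ∈ T, w ∈ languageOfLength X (n + 1))
    (hT' : ∀ w ∈ T, ∃ w' ∈ languageOfLength X (n + 1), w' ∉ T ∧ w'.dropLast = w.dropLast) :
    complexity X n + T.card ≤ complexity X (n + 1) := by
  have h1 : languageOfLength X n ⊆ List.dropLast '' (languageOfLength X (n + 1) \ ↑T) := by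
    rintro w ⟨x, hx, i, rfl⟩
    have h2 : block x i (n + 1) ∈ languageOfLength X (n + 1) := ⟨x, hx, i, rfl⟩
    have h3 : (block x i (n + 1)).dropLast = block x i n := by
      rw [block_add]
      have : block x (i + n) 1 = [x (i + n)] := by simp [block]
      rw [this, List.dropLast_concat]
    by_cases h4 : block x i (n + 1) ∈ T
    · obtain ⟨w', hw', h5, h6⟩ := hT' _ h4
      exact ⟨w', ⟨hw', h5⟩, h6.trans h3⟩
    · exact ⟨_, ⟨h2, h4⟩, h3⟩
  have hf := finite_languageOfLength X (n + 1)
  have h2 : complexity X n ≤ (languageOfLength X (n + 1) \ ↑T).ncard :=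
    (Set.ncard_le_ncard h1 ((hf.subset Set.sdiff_subset).image _)).trans
      (Set.ncard_image_le (hf.subset Set.sdiff_subset))
  have h3 := Set.ncard_sdiff_add_ncard_of_subset (s := (↑T : Set (List A)))
    (t := languageOfLength X (n + 1)) (fun w hw => hT w hw) hf
  rw [Set.ncard_coe_finset] at h3
  unfold complexity at *
  omega

/-- `w` is right special with the continuations `a` and `b`. -/
def RightSpecial {A : Type*} (X : Set (ℤ → A)) (w : List A) (a b : A) : Prop :=
  a ≠ b ∧ w ++ [a] ∈ Lang X ∧ w ++ [b] ∈ Lang X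

lemma RightSpecial.of_suffix {A : Type*} {X : Set (ℤ → A)} {w w' : List A} {a b : A}
    (h : RightSpecial X w a b) (hw : w' <:+ w) : RightSpecial X w' a b := by
  obtain ⟨t, rfl⟩ := hw
  refine ⟨h.1, lang_of_infix h.2.1 ⟨t, [], by simp⟩, lang_of_infix h.2.2 ⟨t, [], by simp⟩⟩

lemma RightSpecial.succ_le {X : Set (ℤ → A)} {w : List A} {a b : A}
    (h : RightSpecial X w a b) :
    complexity X w.length + 1 ≤ complexity X (w.length + 1) := by
  have := complexity_add_card_le (X := X) (n := w.length) {w ++ [a]}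
    (by simpa [mem_languageOfLength] using h.2.1)
    (by
      simp only [Finset.mem_singleton, forall_eq]
      exact ⟨w ++ [b], by simpa [mem_languageOfLength] using h.2.2,
        by simpa using h.1.symm, by simp⟩)
  simpa using this

lemma RightSpecial.add_two_le {X : Set (ℤ → A)} {w w' : List A} {a b a' b' : A}
    (h : RightSpecial X w a b) (h' : RightSpecial X w' a' b') (hl : w.length = w'.length)
    (hne : w ≠ w') :
    complexity X w.length + 2 ≤ complexity X (w.length + 1) := by
  classical
  have hd : ∀ c c' : A, w ++ [c] ≠ w' ++ [c'] := fun c c' he =>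
    hne (List.append_inj_left he hl)
  have := complexity_add_card_le (X := X) (n := w.length) {w ++ [a], w' ++ [a']}
    (by
      simp only [Finset.mem_insert, Finset.mem_singleton, forall_eq_or_imp, forall_eq,
        mem_languageOfLength]
      exact ⟨⟨h.2.1, by simp⟩, h'.2.1, by simp [hl]⟩)
    (by
      simp only [Finset.mem_insert, Finset.mem_singleton, forall_eq_or_imp, forall_eq,
        mem_languageOfLength, not_or]
      exact ⟨⟨w ++ [b], ⟨h.2.2, by simp⟩, ⟨by simpa using h.1.symm, hd _ _⟩, by simp⟩,
        ⟨w' ++ [b'], ⟨h'.2.2, by simp [hl]⟩, ⟨fun e => hd _ _ e.symm, by simpa using h'.1.symm⟩,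
          by simp⟩⟩)
  rwa [Finset.card_pair (hd _ _)] at this

lemma RightSpecial.add_two_le_of_three {X : Set (ℤ → A)} {w : List A} {a b c : A}
    (h : RightSpecial X w a b) (hc : w ++ [c] ∈ Lang X) (hca : c ≠ a) (hcb : c ≠ b) :
    complexity X w.length + 2 ≤ complexity X (w.length + 1) := by
  classical
  have := complexity_add_card_le (X := X) (n := w.length) {w ++ [a], w ++ [b]}
    (by
      simp only [Finset.mem_insert, Finset.mem_singleton, forall_eq_or_imp, forall_eq,
        mem_languageOfLength]
      exact ⟨⟨h.2.1, by simp⟩, h.2.2, by simp⟩)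
    (by
      intro z hz
      refine ⟨w ++ [c], mem_languageOfLength.2 ⟨hc, by simp⟩, by simp [hca, hcb], ?_⟩
      simp only [Finset.mem_insert, Finset.mem_singleton] at hz
      rcases hz with rfl | rfl <;> simp)
  rwa [Finset.card_pair (by simpa using h.1)] at this

end Counting

/-! ### Minimality: uniform recurrence and aperiodicity -/

section Minimal

variable {A : Type*}

/-- Uniform recurrence, together with the absence of long periodic words of a given period. -/
structure MinimalAperiodic (X : Set (ℤ → A)) : Prop where
  nonempty : X.Nonempty
  recurrent : ∀ w ∈ Lang X, ∃ N : ℕ, ∀ x ∈ X, ∀ j : ℤ, ∃ i, j ≤ i ∧ i ≤ j + N ∧ At x i w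
  aperiodic : ∀ d : ℕ, 0 < d → ∃ n : ℕ, ∀ x ∈ X, ∀ i : ℤ, ∃ l < n,
    x (i + (l : ℕ)) ≠ x (i + (l : ℕ) + d)

lemma at_shift {x : ℤ → A} {g i : ℤ} {w : List A} : At (shift g x) i w ↔ At x (g + i) w := by
  simp [at_iff, add_assoc]

variable [TopologicalSpace A]

lemma isOpen_at [DiscreteTopology A] (i : ℤ) (w : List A) : IsOpen {x : ℤ → A | At x i w} := by
  have : {x : ℤ → A | At x i w} = ⋂ k : Fin w.length, (fun x : ℤ → A => x (i + k)) ⁻¹' {w[k]} := by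
    ext x
    simp only [Set.mem_ofPred_eq, Set.mem_iInter, Set.mem_preimage, Set.mem_singleton_iff, at_iff]
    exact ⟨fun h k => h k k.2, fun h k hk => h ⟨k, hk⟩⟩
  rw [this]
  exact isOpen_iInter_of_finite fun k => (isOpen_discrete _).preimage (continuous_apply _)

lemma mem_of_blocks_mem_lang (X : Subshift A ℤ) {x : ℤ → A}
    (h : ∀ i n, block x i n ∈ Lang X.carrier) : x ∈ X.carrier := by
  have key : ∀ N : ℕ, ∃ y ∈ X.carrier, ∀ k : ℤ, -N ≤ k → k ≤ N → y k = x k := by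
    intro N
    obtain ⟨y, hy, i, hi⟩ := h (-N) (2 * N + 1)
    refine ⟨shift (i + N) y, X.mapsTo _ hy, fun k h1 h2 => ?_⟩
    have h3 : block y i (2 * N + 1) = block x (-N) (2 * N + 1) := by
      have := hi; unfold At at this; simpa using this
    have h4 := (block_eq_block_iff.1 h3) (k + N).toNat (by omega)
    rw [shift_apply]
    convert h4 using 2 <;> omega
  choose y hy hyx using key
  refine X.isClosed.mem_of_tendsto (f := y) (b := atTop) ?_ (Eventually.of_forall hy)
  rw [tendsto_pi_nhds]
  intro k
  refine tendsto_const_nhds.congr' ?_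
  filter_upwards [eventually_ge_atTop k.natAbs] with N hN
  exact (hyx N k (by omega) (by omega)).symm

/-- The points that avoid `w` form a subshift properly contained in X, hence an empty one. So the
open sets on which `w` occurs at `i` cover X, and compactness bounds the waiting time. -/
lemma exists_recurrence_bound [DiscreteTopology A] [Finite A] (X : Subshift A ℤ) (hmin : IsMinimalSubshift X)
    {w : List A} (hw : w ∈ Lang X.carrier) :
    ∃ N : ℕ, ∀ x ∈ X.carrier, ∀ j : ℤ, ∃ i, j ≤ i ∧ i ≤ j + N ∧ At x i w := by
  have hcov : X.carrier ⊆ ⋃ i : ℤ, {x : ℤ → A | At x i w} := by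
    by_contra hc
    obtain ⟨x, hx, hxn⟩ := Set.not_subset.1 hc
    let Y : Subshift A ℤ :=
      { carrier := X.carrier ∩ (⋃ i : ℤ, {x : ℤ → A | At x i w})ᶜ
        isClosed := X.isClosed.inter (isOpen_iUnion fun i => isOpen_at i w).isClosed_compl
        mapsTo := by
          intro g y hy
          refine ⟨X.mapsTo g hy.1, ?_⟩
          have h2 := hy.2
          simp only [Set.mem_compl_iff, Set.mem_iUnion, Set.mem_ofPred_eq, not_exists,
            at_shift] at h2 ⊢
          exact fun i => h2 _ }
    have hY := hmin.2 Y ⟨x, hx, hxn⟩ Set.inter_subset_left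
    obtain ⟨y, hy, i, hi⟩ := hw
    rw [← hY] at hy
    exact hy.2 (Set.mem_iUnion.2 ⟨i, hi⟩)
  obtain ⟨F, hF⟩ := X.isClosed.isCompact.elim_finite_subcover _ (fun i => isOpen_at i w) hcov
  obtain ⟨B, hB⟩ : ∃ B : ℕ, ∀ i ∈ F, i.natAbs ≤ B :=
    ⟨F.sup Int.natAbs, fun i hi => Finset.le_sup (f := Int.natAbs) hi⟩
  refine ⟨2 * B, fun x hx j => ?_⟩
  have h1 := hF (X.mapsTo (j + B) hx)
  simp only [Set.mem_iUnion, Set.mem_ofPred_eq, at_shift, exists_prop] at h1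
  obtain ⟨i, hi, h2⟩ := h1
  have := hB i hi
  exact ⟨_, by omega, by push_cast; omega, h2⟩

lemma IsMinimalSubshift.minimalAperiodic [DiscreteTopology A] [Finite A] {X : Subshift A ℤ}
    (hmin : IsMinimalSubshift X) (hinf : X.carrier.Infinite) : MinimalAperiodic X.carrier where
  nonempty := hmin.1
  recurrent w hw := exists_recurrence_bound X hmin hw
  aperiodic d hd := by
    by_contra! hc
    refine hinf ?_
    -- By recurrence every block of every point reappears inside a long stretch of period `d`, so
    -- all points have period `d`; there are only finitely many such points.
    have hper : ∀ x ∈ X.carrier, ∀ k : ℤ, x k = x (k + d) := by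
      intro x hx k
      obtain ⟨N, hN⟩ := exists_recurrence_bound X hmin
        (w := block x k (d + 1)) ⟨x, hx, k, at_block _ _ _⟩
      obtain ⟨y, hy, i, hi⟩ := hc (N + 1)
      obtain ⟨j, h1, h2, h3⟩ := hN y hy i
      have h3 : block y j (d + 1) = block x k (d + 1) := by
        have := h3; unfold At at this; simpa using this
      rw [block_eq_block_iff] at h3
      have e0 := h3 0 (by omega)
      have e1 := h3 d (by omega)
      have e2 := hi (j - i).toNat (by omega)
      rw [show i + (((j - i).toNat : ℕ) : ℤ) = j by omega] at e2
      simp only [Nat.cast_zero, add_zero] at e0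
      rw [← e0, ← e1, e2]
    have hmod : ∀ x ∈ X.carrier, ∀ k : ℤ, x k = x (k % d) := by
      intro x hx k
      have hp : Function.Periodic x (d : ℤ) := fun k => (hper x hx k).symm
      conv_lhs => rw [← Int.emod_add_mul_ediv k d]
      rw [mul_comm]
      exact hp.int_mul _ _
    refine Set.Finite.of_injOn (f := fun x : ℤ → A => fun k : Fin d => x (k : ℕ))
      (t := Set.univ) (fun _ _ => trivial) ?_ Set.finite_univ
    intro x hx y hy hxy
    funext k
    have hd' : (0 : ℤ) < d := by exact_mod_cast hd
    have h1 := Int.emod_nonneg k hd'.ne'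
    have h2 := Int.emod_lt_of_pos k hd'
    have := congrFun hxy ⟨(k % d).toNat, by omega⟩
    simp only [Int.toNat_of_nonneg h1] at this
    rw [hmod x hx, hmod y hy, this]

end Minimal

/-! ### The Morse–Hedlund lower bound -/

section MorseHedlund

variable {A : Type*} {X : Set (ℤ → A)}

/-- Otherwise blocks of length `q` determine the next letter. Some block repeats in a point, which
is then periodic from there on. -/
lemma MinimalAperiodic.exists_rightSpecial [Finite A] (hX : MinimalAperiodic X) (q : ℕ) :
    ∃ w a b, w.length = q ∧ RightSpecial X w a b := by
  by_contra hc
  push Not at hc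
  obtain ⟨x, hx⟩ := hX.nonempty
  have hdet : ∀ i j : ℤ, block x i q = block x j q → x (i + q) = x (j + q) := by
    intro i j hij
    by_contra hne
    have h1 : ∀ i : ℤ, block x i q ++ [x (i + q)] ∈ Lang X := fun i =>
      ⟨x, hx, i, at_append.2 ⟨at_block _ _ _, by simp⟩⟩
    exact hc (block x i q) _ _ (by simp) ⟨hne, h1 i, hij ▸ h1 j⟩
  have : Finite {w : List A // w ∈ languageOfLength X q} := finite_languageOfLength X q
  obtain ⟨i, j, hij, he⟩ := Finite.exists_ne_map_eq_of_infinite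
    (fun i : ℕ => (⟨block x i q, x, hx, i, rfl⟩ : {w : List A // w ∈ languageOfLength X q}))
  replace he : block x (i : ℤ) q = block x (j : ℤ) q := congrArg Subtype.val he
  wlog hlt : i < j generalizing i j
  · exact this j i hij.symm he.symm (lt_of_le_of_ne (not_lt.1 hlt) hij.symm)
  have hall : ∀ l : ℕ, block x (i + l : ℤ) q = block x (j + l : ℤ) q := by
    intro l
    induction l with
    | zero => simpa using he
    | succ l ih =>
      rw [block_eq_block_iff]
      intro k hk
      push_cast
      rcases Nat.lt_or_ge (k + 1) q with h | h
      · have := block_eq_block_iff.1 ih (k + 1) h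
        push_cast at this
        convert this using 2 <;> ring
      · have := hdet _ _ ih
        convert this using 2 <;> omega
  obtain ⟨n, hn⟩ := hX.aperiodic (j - i) (by omega)
  obtain ⟨l, -, hl⟩ := hn x hx (i + q)
  apply hl
  have := hdet _ _ (hall l)
  convert this using 2 <;> push_cast [hlt.le] <;> ring

lemma MinimalAperiodic.complexity_succ_le [Finite A] (hX : MinimalAperiodic X) (q : ℕ) :
    complexity X q + 1 ≤ complexity X (q + 1) := by
  obtain ⟨w, a, b, rfl, h⟩ := hX.exists_rightSpecial q
  exact h.succ_le

lemma MinimalAperiodic.succ_le_complexity [Finite A] (hX : MinimalAperiodic X) (q : ℕ) :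
    q + 1 ≤ complexity X q := by
  induction q with
  | zero =>
    obtain ⟨x, hx⟩ := hX.nonempty
    have : (languageOfLength X 0).Nonempty := ⟨block x 0 0, x, hx, 0, rfl⟩
    exact (Set.ncard_pos (finite_languageOfLength X 0)).2 this
  | succ q ih => exact (Nat.succ_le_succ ih).trans (hX.complexity_succ_le q)

lemma MinimalAperiodic.exists_period_bound (hX : MinimalAperiodic X) (Q : ℕ) :
    ∃ n : ℕ, ∀ d : ℕ, 0 < d → d < Q → ∀ x ∈ X, ∀ i : ℤ, ∃ l < n,
      x (i + (l : ℕ)) ≠ x (i + (l : ℕ) + d) := by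
  induction Q with
  | zero => exact ⟨0, by omega⟩
  | succ Q ih =>
    obtain ⟨n, hn⟩ := ih
    rcases Nat.eq_zero_or_pos Q with rfl | hQ
    · exact ⟨0, by omega⟩
    obtain ⟨n', hn'⟩ := hX.aperiodic Q hQ
    refine ⟨max n n', fun d h0 hd x hx i => ?_⟩
    rcases Nat.lt_or_ge d Q with h | h
    · obtain ⟨l, hl, h3⟩ := hn d h0 h x hx i
      exact ⟨l, lt_max_of_lt_left hl, h3⟩
    · obtain rfl : d = Q := by omega
      obtain ⟨l, hl, h3⟩ := hn' x hx i
      exact ⟨l, lt_max_of_lt_right hl, h3⟩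

end MorseHedlund

/-! ### Levels and the coded language -/

section Coding

variable {A : Type*}

/-- The concatenation of copies of `v` and `u` coded by a binary word. -/
def phi (v u : List A) (c : List Bool) : List A := c.flatMap fun y => if y then u else v

@[simp] lemma phi_nil (v u : List A) : phi v u [] = [] := rfl

@[simp] lemma phi_cons_false (v u : List A) (c : List Bool) :
    phi v u (false :: c) = v ++ phi v u c := by simp [phi]

@[simp] lemma phi_cons_true (v u : List A) (c : List Bool) :
    phi v u (true :: c) = u ++ phi v u c := by simp [phi]

@[simp] lemma phi_append (v u : List A) (c c' : List Bool) :
    phi v u (c ++ c') = phi v u c ++ phi v u c' := by simp [phi]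

lemma phi_replicate_false (v u : List A) (n : ℕ) :
    phi v u (List.replicate n false) = wpow v n := by
  simp [phi, wpow, List.flatMap_replicate]

lemma length_wpow (w : List A) (n : ℕ) : (wpow w n).length = n * w.length := by
  simp [wpow]

lemma wpow_add (w : List A) (m n : ℕ) : wpow w (m + n) = wpow w m ++ wpow w n := by
  simp [wpow, ← List.replicate_append_replicate]

lemma wpow_one (w : List A) : wpow w 1 = w := by simp [wpow]

@[simp] lemma length_phi_replicate_false (v u : List A) (n : ℕ) :
    (phi v u (List.replicate n false)).length = n * v.length := by
  rw [phi_replicate_false, length_wpow]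

lemma phi_flatten_replicate (v u : List A) (c : List Bool) (n : ℕ) :
    phi v u (wpow c n) = wpow (phi v u c) n := by
  induction n with
  | zero => simp [wpow]
  | succ n ih => rw [wpow_add, wpow_add, phi_append, ih, wpow_one, wpow_one]

/-- The position `i` of `x` is preceded by `s` and followed by `p`. -/
def Cut (s p : List A) (x : ℤ → A) (i : ℤ) : Prop := At x (i - s.length) (s ++ p)

/-- The coded word `c` occurs in `x` from the cut at `i` on. -/
def CAt (v u s p : List A) (x : ℤ → A) (i : ℤ) (c : List Bool) : Prop :=
  At x (i - s.length) (s ++ (phi v u c ++ p))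

/-- The language of the coded sequences. -/
def CLang (X : Set (ℤ → A)) (v u s p : List A) : Set (List Bool) :=
  {c | s ++ (phi v u c ++ p) ∈ Lang X}

/-- A pair of words `v`, `u` such that the points of `X` are concatenations of `v` and `u`, cut
precisely where `s` ends and `p` starts. -/
structure Level (X : Set (ℤ → A)) (v u s p : List A) : Prop where
  len : v.length < u.length
  suf : v <:+ u
  -- `pre` and `left` express that the marks are maximal: one more letter to the right of `p`, or to
  -- the left of `s`, tells `v` from `u`.
  pre : ∃ a b, a ≠ b ∧ p ++ [a] <+: v ∧ p ++ [b] <+: u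
  left : ∃ c d, c ≠ d ∧ c :: s <:+ s ++ v ∧ d :: s <:+ s ++ u
  short : p.length + s.length < v.length + u.length
  occ : s ++ p ∈ Lang X
  next : ∀ x ∈ X, ∀ i, Cut s p x i →
    (At x i v ∧ Cut s p x (i + v.length) ∧ ∀ j, i < j → j < i + v.length → ¬ Cut s p x j) ∨
    (At x i u ∧ Cut s p x (i + u.length) ∧ ∀ j, i < j → j < i + u.length → ¬ Cut s p x j)

lemma cat_iff {v u s p : List A} {x : ℤ → A} {i : ℤ} {c : List Bool} :
    CAt v u s p x i c ↔ At x (i - s.length) s ∧ At x i (phi v u c ++ p) := by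
  unfold CAt
  rw [at_append, sub_add_cancel]

lemma cat_nil {v u s p : List A} {x : ℤ → A} {i : ℤ} :
    CAt v u s p x i [] ↔ Cut s p x i := by simp [CAt, Cut]

lemma cut_iff {s p : List A} {x : ℤ → A} {i : ℤ} :
    Cut s p x i ↔ At x (i - s.length) s ∧ At x i p := by
  unfold Cut
  rw [at_append, sub_add_cancel]

lemma mem_cLang {X : Set (ℤ → A)} {v u s p : List A} {c : List Bool} :
    c ∈ CLang X v u s p ↔ ∃ x ∈ X, ∃ i, CAt v u s p x i c := by
  constructor
  · rintro ⟨x, hx, i, h⟩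
    exact ⟨x, hx, i + s.length, by unfold CAt; rwa [add_sub_cancel_right]⟩
  · rintro ⟨x, hx, i, h⟩
    exact ⟨x, hx, _, h⟩

namespace Level

variable {X : Set (ℤ → A)} {v u s p : List A}

lemma length_pos (L : Level X v u s p) : 0 < v.length := by
  obtain ⟨a, b, -, h, -⟩ := L.pre
  have := h.length_le
  simp at this; omega

lemma p_prefix_v (L : Level X v u s p) : p <+: v := by
  obtain ⟨a, b, -, h, -⟩ := L.pre
  exact (List.prefix_append _ _).trans h

lemma p_prefix_u (L : Level X v u s p) : p <+: u := by
  obtain ⟨a, b, -, -, h⟩ := L.pre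
  exact (List.prefix_append _ _).trans h

lemma s_suffix_v (L : Level X v u s p) : s <:+ s ++ v := by
  obtain ⟨c, d, -, h, -⟩ := L.left
  exact (List.suffix_cons _ _).trans h

lemma s_suffix_u (L : Level X v u s p) : s <:+ s ++ u := by
  obtain ⟨c, d, -, -, h⟩ := L.left
  exact (List.suffix_cons _ _).trans h

lemma p_prefix (L : Level X v u s p) (c : List Bool) : p <+: phi v u c ++ p := by
  cases c with
  | nil => simp
  | cons y c =>
    cases y
    · simpa using L.p_prefix_v.trans (List.prefix_append _ _)
    · simpa using L.p_prefix_u.trans (List.prefix_append _ _)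

lemma s_suffix (L : Level X v u s p) (c : List Bool) : s <:+ s ++ phi v u c := by
  induction c with
  | nil => simp
  | cons y c ih =>
    refine ih.trans ?_
    cases y
    · simpa using (List.suffix_append_self_iff (l₃ := phi v u c)).2 L.s_suffix_v
    · simpa using (List.suffix_append_self_iff (l₃ := phi v u c)).2 L.s_suffix_u

lemma phi_pos (L : Level X v u s p) {c : List Bool} (hc : c ≠ []) : 0 < (phi v u c).length := by
  have h1 := L.length_pos
  have h2 := L.len
  cases c with
  | nil => exact absurd rfl hc
  | cons y c => cases y <;> simp <;> omega

/-- The marks at an inner boundary come for free: `phi v u c' ++ p` starts with `p` and `s ++ phi v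
u c` ends with `s`. So coded occurrences may be cut and glued. -/
lemma cat_append (L : Level X v u s p) {x : ℤ → A} {i : ℤ} {c c' : List Bool} :
    CAt v u s p x i (c ++ c') ↔
      CAt v u s p x i c ∧ CAt v u s p x (i + (phi v u c).length) c' := by
  simp only [cat_iff, phi_append, List.append_assoc]
  constructor
  · rintro ⟨h1, h2⟩
    have h3 := at_append.1 h2
    refine ⟨⟨h1, at_append.2 ⟨h3.1, h3.2.of_prefix (L.p_prefix _)⟩⟩, ?_, h3.2⟩
    have h4 : At x (i - s.length) (s ++ phi v u c) := at_append.2 ⟨h1, by simpa using h3.1⟩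
    exact h4.of_suffix (L.s_suffix c) (by push_cast [List.length_append]; ring)
  · rintro ⟨⟨h1, h2⟩, h3, h4⟩
    exact ⟨h1, at_append.2 ⟨(at_append.1 h2).1, h4⟩⟩

lemma _root_.LowComplexity.CAt.cut (L : Level X v u s p) {x : ℤ → A} {i : ℤ} {c : List Bool}
    (h : CAt v u s p x i c) : Cut s p x i :=
  cat_nil.1 ((L.cat_append (c := []) (c' := c)).1 h).1

lemma cat_infix (L : Level X v u s p) {x : ℤ → A} {i : ℤ} {c₁ c c₂ : List Bool}
    (h : CAt v u s p x i (c₁ ++ (c ++ c₂))) :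
    CAt v u s p x (i + (phi v u c₁).length) c :=
  (L.cat_append.1 (L.cat_append.1 h).2).1

lemma cLang_infix (L : Level X v u s p) {c c' : List Bool} (h : c ∈ CLang X v u s p)
    (hc : c' <:+: c) : c' ∈ CLang X v u s p := by
  obtain ⟨x, hx, i, hi⟩ := mem_cLang.1 h
  obtain ⟨a, b, rfl⟩ := hc
  rw [List.append_assoc] at hi
  exact mem_cLang.2 ⟨x, hx, _, L.cat_infix hi⟩

lemma not_at_both (L : Level X v u s p) {x : ℤ → A} {i : ℤ} (h : At x i v) (h' : At x i u) :
    False := by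
  obtain ⟨a, b, hab, h1, h2⟩ := L.pre
  have := (h.of_prefix h1).eq_of_length (h'.of_prefix h2) (by simp)
  simp at this
  exact hab this

lemma right_unique (L : Level X v u s p) {x : ℤ → A} {i : ℤ} {c c' : List Bool}
    (h : CAt v u s p x i (false :: c)) (h' : CAt v u s p x i (true :: c')) : False := by
  have h1 := (cat_iff.1 h).2
  have h2 := (cat_iff.1 h').2
  simp only [phi_cons_false, phi_cons_true, List.append_assoc] at h1 h2
  exact L.not_at_both (at_append.1 h1).1 (at_append.1 h2).1

/-- The letter just before the `s` that precedes the common end tells `v` from `u`. -/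
lemma left_unique (L : Level X v u s p) {x : ℤ → A} {i j : ℤ} {c c' : List Bool}
    (h : CAt v u s p x i (c ++ [false])) (h' : CAt v u s p x j (c' ++ [true]))
    (hij : i + (phi v u (c ++ [false])).length = j + (phi v u (c' ++ [true])).length) :
    False := by
  have h1 := cat_iff.1 (L.cat_append.1 h).2
  have h2 := cat_iff.1 (L.cat_append.1 h').2
  obtain ⟨y, z, hyz, h3, h4⟩ := L.left
  simp only [phi_cons_false, phi_cons_true, phi_append, phi_nil, List.append_nil,
    List.length_append] at h1 h2 hij
  have h5 := (at_append.2 ⟨h1.1, by simpa using (at_append.1 h1.2).1⟩ : At x _ (s ++ v))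
  have h6 := (at_append.2 ⟨h2.1, by simpa using (at_append.1 h2.2).1⟩ : At x _ (s ++ u))
  set e : ℤ := i + ((phi v u c).length + v.length : ℕ) with he
  have h7 := h5.of_suffix h3 (j := e - (s.length + 1 : ℕ)) (by
    push_cast [List.length_append, List.length_cons, he]; ring)
  have h8 := h6.of_suffix h4 (j := e - (s.length + 1 : ℕ)) (by
    push_cast [List.length_append, List.length_cons] at hij he ⊢; linarith)
  have := h7.eq_of_length h8 (by simp)
  simp at this
  exact hyz this

lemma length_phi_singleton_pos (L : Level X v u s p) (y : Bool) :
    0 < (phi v u [y]).length := L.phi_pos (by simp)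

lemma next_cat (L : Level X v u s p) {x : ℤ → A} (hx : x ∈ X) {i : ℤ} (h : Cut s p x i) :
    ∃ y, CAt v u s p x i [y] ∧
      ∀ j, i < j → j < i + (phi v u [y]).length → ¬ Cut s p x j := by
  have h0 := (cut_iff.1 h).1
  rcases L.next x hx i h with ⟨h1, h2, h3⟩ | ⟨h1, h2, h3⟩
  · exact ⟨false, cat_iff.2 ⟨h0, at_append.2 ⟨by simpa using h1, by simpa using (cut_iff.1 h2).2⟩⟩,
      by simpa using h3⟩
  · exact ⟨true, cat_iff.2 ⟨h0, at_append.2 ⟨by simpa using h1, by simpa using (cut_iff.1 h2).2⟩⟩,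
      by simpa using h3⟩

lemma extend_right (L : Level X v u s p) {x : ℤ → A} (hx : x ∈ X) {i : ℤ} {c : List Bool}
    (h : CAt v u s p x i c) : ∃ y, CAt v u s p x i (c ++ [y]) := by
  have h1 : CAt v u s p x i (c ++ []) := by simpa using h
  obtain ⟨y, hy, -⟩ := L.next_cat hx (cat_nil.1 (L.cat_append.1 h1).2)
  exact ⟨y, L.cat_append.2 ⟨h, hy⟩⟩

lemma _root_.LowComplexity.MinimalAperiodic.exists_cat_ge (hX : MinimalAperiodic X) {x : ℤ → A} (hx : x ∈ X)
    {c : List Bool} (hc : c ∈ CLang X v u s p) :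
    ∃ N : ℕ, ∀ j : ℤ, ∃ i, j ≤ i ∧ i ≤ j + N ∧ CAt v u s p x i c := by
  obtain ⟨N, hN⟩ := hX.recurrent _ hc
  refine ⟨N, fun j => ?_⟩
  obtain ⟨i, h1, h2, h3⟩ := hN x hx (j - s.length)
  exact ⟨i + s.length, by omega, by omega, by unfold CAt; rwa [add_sub_cancel_right]⟩

lemma nil_mem_cLang (L : Level X v u s p) : [] ∈ CLang X v u s p := by
  simpa [CLang] using L.occ

lemma exists_cut (L : Level X v u s p) (hX : MinimalAperiodic X) {x : ℤ → A} (hx : x ∈ X) :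
    ∃ N : ℕ, ∀ j : ℤ, ∃ i, j ≤ i ∧ i ≤ j + N ∧ Cut s p x i := by
  obtain ⟨N, hN⟩ := hX.exists_cat_ge hx L.nil_mem_cLang
  exact ⟨N, fun j => by simpa [cat_nil] using hN j⟩

/-- Every position has a last cut at or before it. -/
lemma exists_last_cut (L : Level X v u s p) (hX : MinimalAperiodic X) {x : ℤ → A} (hx : x ∈ X)
    (i : ℤ) : ∃ j ≤ i, Cut s p x j ∧ ∀ k, j < k → k ≤ i → ¬ Cut s p x k := by
  obtain ⟨N, hN⟩ := L.exists_cut hX hx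
  obtain ⟨j0, -, h2, h3⟩ := hN (i - N)
  obtain ⟨j, ⟨h4, h5⟩, h6⟩ := Int.exists_greatest_of_bdd (P := fun j => j ≤ i ∧ Cut s p x j)
    ⟨i, fun z hz => hz.1⟩ ⟨j0, by omega, h3⟩
  exact ⟨j, h4, h5, fun k hk hk' hc => by have := h6 k ⟨hk', hc⟩; omega⟩

lemma extend_left (L : Level X v u s p) (hX : MinimalAperiodic X) {x : ℤ → A} (hx : x ∈ X)
    {i : ℤ} {c : List Bool} (h : CAt v u s p x i c) :
    ∃ y, CAt v u s p x (i - (phi v u [y]).length) (y :: c) := by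
  obtain ⟨j, hj, hcut, hlast⟩ := L.exists_last_cut hX hx (i - 1)
  obtain ⟨y, hy, hy'⟩ := L.next_cat hx hcut
  have h1 : CAt v u s p x j ([y] ++ []) := by simpa using hy
  have h2 := cat_nil.1 (L.cat_append.1 h1).2
  have h3 : j + (phi v u [y]).length = i := by
    rcases lt_trichotomy (j + ((phi v u [y]).length : ℤ)) i with h4 | h4 | h4
    · exact absurd h2 (hlast _ (by have := L.length_phi_singleton_pos y; omega) (by omega))
    · exact h4
    · exact absurd (h.cut L) (hy' _ (by omega) h4)
  refine ⟨y, ?_⟩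
  rw [show y :: c = [y] ++ c from rfl, L.cat_append, ← h3, add_sub_cancel_right]
  exact ⟨hy, h3 ▸ h⟩

/-- By `next` there are no cuts inside a single `v` or `u`, so a cut within a coded occurrence is
one of its boundaries. -/
lemma cut_split (L : Level X v u s p) {x : ℤ → A} (hx : x ∈ X) {c : List Bool} {i j : ℤ}
    (h : CAt v u s p x i c) (hij : i ≤ j) (hj : j ≤ i + (phi v u c).length)
    (hc : Cut s p x j) : ∃ c₁ c₂, c = c₁ ++ c₂ ∧ j = i + (phi v u c₁).length := by
  induction c generalizing i with
  | nil => exact ⟨[], [], rfl, by simp at hj ⊢; omega⟩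
  | cons y c ih =>
    rcases eq_or_lt_of_le hij with rfl | hij
    · exact ⟨[], y :: c, rfl, by simp⟩
    obtain ⟨h1, h2⟩ := (L.cat_append (c := [y])).1 h
    obtain ⟨z, hz, hz'⟩ := L.next_cat hx (h.cut L)
    have hyz : z = y := by
      cases y <;> cases z
      · rfl
      · exact (L.right_unique h1 hz).elim
      · exact (L.right_unique hz h1).elim
      · rfl
    subst hyz
    obtain ⟨c₁, c₂, rfl, h4⟩ := ih h2 (not_lt.1 fun h => hz' _ hij h hc) (by
      rw [← List.singleton_append, phi_append, List.length_append] at hj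
      push_cast at hj; omega)
    refine ⟨z :: c₁, c₂, rfl, ?_⟩
    rw [← List.singleton_append, phi_append, List.length_append]
    push_cast; omega

lemma exists_wpow_notMem (L : Level X v u s p) (hX : MinimalAperiodic X) {c : List Bool}
    (hc : c ≠ []) : ∃ N, wpow c N ∉ CLang X v u s p := by
  obtain ⟨n, hn⟩ := hX.aperiodic (phi v u c).length (L.phi_pos hc)
  refine ⟨n + 1, fun h => ?_⟩
  obtain ⟨x, hx, i, hi⟩ := mem_cLang.1 h
  have h1 := (at_append.1 (cat_iff.1 hi).2).1
  have h2 := h1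
  rw [phi_flatten_replicate, wpow_add, wpow_one] at h1
  rw [phi_flatten_replicate, add_comm n, wpow_add, wpow_one] at h2
  replace h1 := (at_append.1 h1).1
  replace h2 := (at_append.1 h2).2
  obtain ⟨l, hl, hne⟩ := hn x hx i
  apply hne
  have hl' : l < (wpow (phi v u c) n).length := by
    rw [length_wpow]; exact hl.trans_le (Nat.le_mul_of_pos_right _ (L.phi_pos hc))
  rw [at_iff.1 h1 l hl', ← at_iff.1 h2 l hl']
  congr 1; ring

lemma wpow_singleton (y : Bool) (n : ℕ) : wpow [y] n = List.replicate n y := by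
  simp [wpow]

lemma extend_right_gap (L : Level X v u s p) (hX : MinimalAperiodic X) {x : ℤ → A} (hx : x ∈ X)
    {i : ℤ} {c : List Bool} (h : CAt v u s p x i c) :
    ∃ k, CAt v u s p x i (c ++ (List.replicate k false ++ [true])) := by
  by_contra! hc
  have key : ∀ k, CAt v u s p x i (c ++ List.replicate k false) := by
    intro k
    induction k with
    | zero => simpa using h
    | succ k ih =>
      obtain ⟨y, hy⟩ := L.extend_right hx ih
      cases y
      · rwa [List.append_assoc, ← List.replicate_succ'] at hy
      · exact absurd (by rwa [List.append_assoc] at hy) (hc k)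
  obtain ⟨N, hN⟩ := L.exists_wpow_notMem hX (c := [false]) (by simp)
  rw [wpow_singleton] at hN
  exact hN (mem_cLang.2 ⟨x, hx, _, (L.cat_append.1 (key N)).2⟩)

lemma extend_left_gap (L : Level X v u s p) (hX : MinimalAperiodic X) {x : ℤ → A} (hx : x ∈ X)
    {i : ℤ} {c : List Bool} (h : CAt v u s p x i c) :
    ∃ k, CAt v u s p x (i - (phi v u (true :: List.replicate k false)).length)
      (true :: (List.replicate k false ++ c)) := by
  by_contra! hc
  have key : ∀ k, CAt v u s p x (i - (phi v u (List.replicate k false)).length)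
      (List.replicate k false ++ c) := by
    intro k
    induction k with
    | zero => simpa using h
    | succ k ih =>
      obtain ⟨y, hy⟩ := L.extend_left hX hx ih
      cases y
      · convert hy using 1
        · simp; ring
        · simp [List.replicate_succ]
      · exact absurd (by convert hy using 1; simp; ring) (hc k)
  obtain ⟨N, hN⟩ := L.exists_wpow_notMem hX (c := [false]) (by simp)
  rw [wpow_singleton] at hN
  exact hN (mem_cLang.2 ⟨x, hx, _, (L.cat_append.1 (key N)).1⟩)

end Level

end Coding

/-! ### Right special coded words and the main count -/

section Special

variable {A : Type*} {X : Set (ℤ → A)} {v u s p : List A}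

/-- Right special words of the coded language. -/
def CSpecial (X : Set (ℤ → A)) (v u s p : List A) (c : List Bool) : Prop :=
  c ++ [false] ∈ CLang X v u s p ∧ c ++ [true] ∈ CLang X v u s p

namespace Level

lemma exists_rightSpecial (L : Level X v u s p) :
    ∃ a b, ∀ c, CSpecial X v u s p c → RightSpecial X (s ++ (phi v u c ++ p)) a b := by
  obtain ⟨a, b, hab, h1, h2⟩ := L.pre
  refine ⟨a, b, fun c hc => ⟨hab, lang_of_infix hc.1 ?_, lang_of_infix hc.2 ?_⟩⟩
  · apply List.IsPrefix.isInfix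
    simp only [phi_append, List.append_assoc, List.prefix_append_right_inj, phi_cons_false,
      phi_nil, List.nil_append]
    exact h1.trans (List.prefix_append _ _)
  · apply List.IsPrefix.isInfix
    simp only [phi_append, List.append_assoc, List.prefix_append_right_inj, phi_cons_true,
      phi_nil, List.nil_append]
    exact h2.trans (List.prefix_append _ _)

/-- Two long right special words with the maximal common suffix `e` force a high complexity. -/
lemma not_special_pair [Finite A] (L : Level X v u s p) (hX : MinimalAperiodic X)
    (hq : ∀ q, v.length ≤ q → 2 * complexity X q < 3 * q) {c₀ c₁ e : List Bool}
    (h0 : CSpecial X v u s p (c₀ ++ false :: e)) (h1 : CSpecial X v u s p (c₁ ++ true :: e))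
    (hl0 : v.length + u.length + 2 * (phi v u e).length ≤ (phi v u (c₀ ++ false :: e)).length)
    (hl1 : v.length + u.length + 2 * (phi v u e).length ≤ (phi v u (c₁ ++ true :: e)).length) :
    False := by
  obtain ⟨a, b, hab⟩ := L.exists_rightSpecial
  obtain ⟨y, z, hyz, h3, h4⟩ := L.left
  have r0 := hab _ h0
  have r1 := hab _ h1
  -- The letters `y ≠ z` in front of `s ++ phi v u e ++ p` separate the two words: all longer
  -- suffixes of them differ.
  have s0 : y :: (s ++ (phi v u e ++ p)) <:+ s ++ (phi v u (c₀ ++ false :: e) ++ p) := by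
    have h5 := h3.trans ((List.suffix_append_self_iff (l₃ := v)).2 (L.s_suffix c₀))
    have h6 := (List.suffix_append_self_iff (l₃ := phi v u e ++ p)).2 h5
    simpa using h6
  have s1 : z :: (s ++ (phi v u e ++ p)) <:+ s ++ (phi v u (c₁ ++ true :: e) ++ p) := by
    have h5 := h4.trans ((List.suffix_append_self_iff (l₃ := u)).2 (L.s_suffix c₁))
    have h6 := (List.suffix_append_self_iff (l₃ := phi v u e ++ p)).2 h5
    simpa using h6
  generalize hw0 : s ++ (phi v u (c₀ ++ false :: e) ++ p) = w0 at *
  generalize hw1 : s ++ (phi v u (c₁ ++ true :: e) ++ p) = w1 at *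
  have e0 : w0.length = s.length + (phi v u (c₀ ++ false :: e)).length + p.length := by
    rw [← hw0]; simp; ring
  have e1 : w1.length = s.length + (phi v u (c₁ ++ true :: e)).length + p.length := by
    rw [← hw1]; simp; ring
  set M := v.length + u.length + 2 * (phi v u e).length with hM
  set E := (phi v u e).length with hE
  -- The start is the bound `q + 1`. Each further length has two different right special words,
  -- suffixes of `w0` and `w1`, and contributes 2.
  have key : ∀ t, t + E ≤ M →
      s.length + p.length + E + 2 + 2 * t ≤ complexity X (s.length + p.length + E + 1 + t) := by
    intro t
    induction t with
    | zero =>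
      intro _
      exact hX.succ_le_complexity _
    | succ t ih =>
      intro ht
      have ih := ih (by omega)
      have d0 : w0.drop (w0.length - (s.length + p.length + E + 1 + t)) <:+ w0 :=
        List.drop_suffix _ _
      have d1 : w1.drop (w1.length - (s.length + p.length + E + 1 + t)) <:+ w1 :=
        List.drop_suffix _ _
      have l0 : (w0.drop (w0.length - (s.length + p.length + E + 1 + t))).length =
        s.length + p.length + E + 1 + t := by rw [List.length_drop]; omega
      have l1 : (w1.drop (w1.length - (s.length + p.length + E + 1 + t))).length =
        s.length + p.length + E + 1 + t := by rw [List.length_drop]; omega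
      have := (r0.of_suffix d0).add_two_le (r1.of_suffix d1) (by rw [l0, l1]) (by
        intro he
        have t0 := List.suffix_of_suffix_length_le s0 d0 (by rw [l0]; simp; omega)
        have t1 := List.suffix_of_suffix_length_le s1 d1 (by rw [l1]; simp; omega)
        rw [← he] at t1
        have t2 := List.suffix_of_suffix_length_le t0 t1 (by simp)
        have t3 := t2.eq_of_length (by simp)
        simp at t3
        exact hyz t3)
      rw [l0] at this
      rw [← add_assoc]
      omega
  -- At q = |s|+|p|+1+M twice the complexity is at least 2(|s|+|p|)+4+4M-2E. As M-2E = |v|+|u|, this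
  -- is at least 3q once |s|+|p| ≤ |v|+|u|+1.
  have k1 := key (M - E) (by omega)
  have k2 := hq (s.length + p.length + E + 1 + (M - E)) (by omega)
  have k3 := L.short
  omega

end Level

end Special

/-! ### The derived level -/

section Derive

variable {A : Type*} {X : Set (ℤ → A)} {v u s p : List A}

/-- The word `0 ⋯ 0` of length `n`. -/
abbrev zeros (n : ℕ) : List Bool := List.replicate n false

lemma zeros_add (m n : ℕ) : zeros (m + n) = zeros m ++ zeros n := by
  simp [zeros, ← List.replicate_append_replicate]

/-- The only letters 1 in 0^k 1 t are the one after 0^k and the last letter of t, so a split after a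
1 with nonempty rest is the split in front of t. -/
lemma eq_tail_of_append_eq {k r : ℕ} {c₁ c₂ t : List Bool} (ht : t = [] ∨ t = zeros r ++ [true])
    (h : zeros k ++ true :: t = (c₁ ++ [true]) ++ c₂) (h2 : c₂ ≠ []) :
    c₂ = t ∧ t = zeros r ++ [true] := by
  have hc : c₂ = t := by
    rw [List.append_assoc, List.append_eq_append_iff] at h
    rcases h with ⟨a, rfl, h⟩ | ⟨b, hb, h⟩
    · rcases a with _ | ⟨y, a⟩
      · simp at h; exact h.symm
      · simp only [List.cons_append, List.cons.injEq, List.nil_append] at h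
        exfalso
        rcases ht with rfl | rfl
        · simp at h
        · rcases List.eq_nil_or_concat c₂ with rfl | ⟨c, z, rfl⟩
          · exact h2 rfl
          · have h3 := congrArg List.dropLast h.2
            rw [List.concat_eq_append, ← List.cons_append, ← List.append_assoc,
              List.dropLast_concat, List.dropLast_concat] at h3
            have : true ∈ zeros r := by rw [h3]; simp
            simp [zeros] at this
    · rcases b with _ | ⟨y, b⟩
      · simpa using h
      · simp only [List.cons_append, List.cons.injEq, List.nil_append] at h
        have : true ∈ zeros k := by rw [hb, h.1]; simp
        simp [zeros] at this
  refine ⟨hc, ?_⟩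
  subst hc
  exact ht.resolve_left h2

namespace Level

/-- A new cut is a place in the coded sequence preceded by 0^g 1 t and followed by 0^g. Since the
new u is the new v with copies of v put in front, the marks are controlled by those of the old
level. -/
lemma derive (L : Level X v u s p) {g h : ℕ} (hgh : g < h) {t : List Bool}
    (ht : t = [] ∨ ∃ r < g, t = zeros r ++ [true])
    (hocc : (zeros g ++ true :: t) ++ zeros g ∈ CLang X v u s p)
    (hnext : ∀ x ∈ X, ∀ i, CAt v u s p x i ((zeros g ++ true :: t) ++ zeros g) →
      ∃ k, (k = g ∨ k = h) ∧
        CAt v u s p x i ((zeros g ++ true :: t) ++ ((zeros k ++ true :: t) ++ zeros g))) :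
    Level X (phi v u (zeros g ++ true :: t)) (phi v u (zeros h ++ true :: t))
      (s ++ phi v u (zeros g ++ true :: t)) (phi v u (zeros g) ++ p) := by
  obtain ⟨e, rfl⟩ := Nat.exists_eq_add_of_lt hgh
  have hV := L.length_pos
  have hlast : ∃ t', zeros g ++ true :: t = t' ++ [true] := by
    rcases ht with rfl | ⟨r, -, rfl⟩
    · exact ⟨_, rfl⟩
    · exact ⟨zeros g ++ true :: zeros r, by simp⟩
  have hsplit : zeros (g + e + 1) ++ true :: t = zeros (e + 1) ++ (zeros g ++ true :: t) := by
    rw [show g + e + 1 = (e + 1) + g by ring, zeros_add, List.append_assoc]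
  have hcut : ∀ x i, Cut (s ++ phi v u (zeros g ++ true :: t)) (phi v u (zeros g) ++ p) x i ↔
      CAt v u s p x (i - (phi v u (zeros g ++ true :: t)).length)
        ((zeros g ++ true :: t) ++ zeros g) := by
    intro x i
    unfold Cut CAt
    rw [phi_append v u (zeros g ++ true :: t) (zeros g)]
    simp only [List.append_assoc, List.length_append]
    rw [show i - ((s.length + (phi v u (zeros g ++ true :: t)).length : ℕ) : ℤ) =
      i - (phi v u (zeros g ++ true :: t)).length - s.length by push_cast; ring]
  have hlenV : g * v.length + u.length ≤ (phi v u (zeros g ++ true :: t)).length := by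
    simp
  have hlenU : (phi v u (zeros (g + e + 1) ++ true :: t)).length =
      (e + 1) * v.length + (phi v u (zeros g ++ true :: t)).length := by
    rw [hsplit, phi_append v u (zeros (e + 1)), List.length_append, length_phi_replicate_false]
  have hev : (e + 1) * v.length = e * v.length + v.length := by ring
  obtain ⟨a, b, hab, ha, hb⟩ := L.pre
  obtain ⟨y, z, hyz, hy, hz⟩ := L.left
  refine ⟨?_, ?_, ?_, ?_, ?_, ?_, ?_⟩
  · rw [hlenU]; omega
  · rw [hsplit, phi_append v u (zeros (e + 1))]
    exact List.suffix_append _ _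
  -- After 0^g the new v goes on with 1 and the new u with 0, so the distinguishing letters are
  -- exchanged.
  · refine ⟨b, a, hab.symm, ?_, ?_⟩
    · simp only [phi_append, List.append_assoc, List.prefix_append_right_inj, phi_cons_true]
      exact hb.trans (List.prefix_append _ _)
    · rw [show zeros (g + e + 1) ++ true :: t = zeros g ++ (false :: (zeros e ++ true :: t)) by
        rw [add_assoc, zeros_add, add_comm e, zeros_add]; simp [zeros]]
      simp only [phi_append, List.append_assoc, List.prefix_append_right_inj, phi_cons_false]
      exact ha.trans (List.prefix_append _ _)
  -- The last copy of the new v is preceded by another one, which ends in 1, in the first case, and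
  -- by 0 inside the new u in the second.
  · refine ⟨z, y, hyz.symm, ?_, ?_⟩
    · obtain ⟨t', ht'⟩ := hlast
      have h1 := hz.trans ((List.suffix_append_self_iff (l₃ := u)).2 (L.s_suffix t'))
      have h2 : z :: s <:+ s ++ phi v u (zeros g ++ true :: t) := by
        rw [ht']; simpa using h1
      have h3 := (List.suffix_append_self_iff (l₃ := phi v u (zeros g ++ true :: t))).2 h2
      simpa only [List.cons_append] using h3
    · have h1 := hy.trans ((List.suffix_append_self_iff (l₃ := v)).2
        (L.s_suffix (zeros g ++ true :: t ++ zeros e)))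
      have h3 := (List.suffix_append_self_iff (l₃ := phi v u (zeros g ++ true :: t))).2 h1
      rw [hsplit, show zeros (e + 1) = zeros e ++ [false] by rw [zeros_add]; rfl]
      simpa using h3
  -- |p'|+|s'| = g|v|+|p|+|s|+|v'| < g|v|+|v|+|u|+|v'| ≤ |v'|+|u'|, since g|v|+|u| ≤ |v'| and
  -- |v|+|v'| ≤ |u'|.
  · rw [hlenU]
    have := L.short
    simp only [List.length_append, length_phi_replicate_false] at hlenV ⊢
    omega
  · have := hocc
    unfold CLang at this
    simpa using this
  · intro x hx i hi
    rw [hcut] at hi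
    obtain ⟨k, hk, hk'⟩ := hnext x hx _ hi
    have hafter := (L.cat_append.1 hk').2
    rw [sub_add_cancel] at hafter
    have hat : At x i (phi v u (zeros k ++ true :: t)) :=
      (at_append.1 (cat_iff.1 (L.cat_append.1 hafter).1).2).1
    have hcut' : Cut (s ++ phi v u (zeros g ++ true :: t)) (phi v u (zeros g) ++ p) x
        (i + (phi v u (zeros k ++ true :: t)).length) := by
      rw [hcut]
      obtain ⟨f, rfl⟩ : ∃ f, k = f + g := ⟨k - g, by rcases hk with rfl | rfl <;> omega⟩
      have h1 : (zeros g ++ true :: t) ++ ((zeros (f + g) ++ true :: t) ++ zeros g) =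
        ((zeros g ++ true :: t) ++ zeros f) ++ ((zeros g ++ true :: t) ++ zeros g) := by
        simp only [zeros_add, List.append_assoc, List.cons_append]
      rw [h1, L.cat_append] at hk'
      convert hk'.2 using 1
      rw [zeros_add, List.append_assoc, phi_append v u (zeros f), phi_append v u _ (zeros f)]
      simp only [List.length_append]
      push_cast; ring
    -- An inner new cut would split 0^k 1 t properly. The left part ends in 1, as the new v does, so
    -- it is 0^k 1 and the rest is 0^r 1. But a new cut is followed by 0^g with g > r.
    have hno : ∀ j, i < j → j < i + (phi v u (zeros k ++ true :: t)).length →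
        ¬ Cut (s ++ phi v u (zeros g ++ true :: t)) (phi v u (zeros g) ++ p) x j := by
      intro j hij hj hc
      rw [hcut] at hc
      have hpast := (L.cat_append.1 hc).1
      have hfut := (L.cat_append.1 hc).2
      rw [sub_add_cancel] at hfut
      obtain ⟨c₁, c₂, hcc, hj'⟩ := L.cut_split hx (L.cat_append.1 hafter).1 hij.le hj.le
        (hfut.cut L)
      have hc1 : c₁ ≠ [] := by rintro rfl; simp at hj'; omega
      have hc2 : c₂ ≠ [] := by rintro rfl; rw [hcc] at hj; simp at hj; omega
      rw [hcc, List.append_assoc] at hafter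
      obtain ⟨h1, h2⟩ := L.cat_append.1 hafter
      obtain ⟨d, w, rfl⟩ : ∃ d w, c₁ = d ++ [w] := by
        rcases List.eq_nil_or_concat c₁ with rfl | ⟨d, w, rfl⟩
        · exact absurd rfl hc1
        · exact ⟨d, w, by simp⟩
      obtain ⟨t', ht'⟩ := hlast
      rw [ht'] at hpast
      cases w
      · exact L.left_unique h1 hpast (by rw [← hj', ← ht']; ring)
      · rcases ht with rfl | ⟨r, hr, rfl⟩
        · have := eq_tail_of_append_eq (r := 0) (Or.inl rfl) hcc hc2
          exact hc2 this.1
        · have := eq_tail_of_append_eq (r := r) (Or.inr rfl) hcc hc2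
          rw [this.1, ← hj', List.append_assoc] at h2
          obtain ⟨f, rfl⟩ := Nat.exists_eq_add_of_lt hr
          rw [add_assoc, zeros_add] at hfut
          have h3 := (L.cat_append.1 hfut).2
          have h4 := (L.cat_append.1 h2).2
          rw [add_comm f, zeros_add] at h3
          exact L.right_unique h3 h4
    rcases hk with rfl | rfl
    · exact Or.inl ⟨hat, hcut', hno⟩
    · exact Or.inr ⟨hat, hcut', hno⟩

end Level

end Derive

/-! ### The possible gaps between letters 1 -/

section Gaps

variable {A : Type*} {X : Set (ℤ → A)} {v u s p : List A}

/-- The numbers of letters `0` between consecutive letters `1` in coded sequences. -/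
def Gaps (X : Set (ℤ → A)) (v u s p : List A) : Set ℕ :=
  {g | true :: (zeros g ++ [true]) ∈ CLang X v u s p}

namespace Level

lemma cLang_extend_right_gap (L : Level X v u s p) (hX : MinimalAperiodic X) {c : List Bool}
    (hc : c ∈ CLang X v u s p) : ∃ k, c ++ (zeros k ++ [true]) ∈ CLang X v u s p := by
  obtain ⟨x, hx, i, hi⟩ := mem_cLang.1 hc
  obtain ⟨k, hk⟩ := L.extend_right_gap hX hx hi
  exact ⟨k, mem_cLang.2 ⟨x, hx, _, hk⟩⟩

lemma cLang_extend_left_gap (L : Level X v u s p) (hX : MinimalAperiodic X) {c : List Bool}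
    (hc : c ∈ CLang X v u s p) : ∃ k, true :: (zeros k ++ c) ∈ CLang X v u s p := by
  obtain ⟨x, hx, i, hi⟩ := mem_cLang.1 hc
  obtain ⟨k, hk⟩ := L.extend_left_gap hX hx hi
  exact ⟨k, mem_cLang.2 ⟨x, hx, _, hk⟩⟩

lemma cLang_extend_left (L : Level X v u s p) (hX : MinimalAperiodic X) {c : List Bool}
    (hc : c ∈ CLang X v u s p) : ∃ y, y :: c ∈ CLang X v u s p := by
  obtain ⟨x, hx, i, hi⟩ := mem_cLang.1 hc
  obtain ⟨k, hk⟩ := L.extend_left hX hx hi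
  exact ⟨k, mem_cLang.2 ⟨x, hx, _, hk⟩⟩

lemma exists_gap (L : Level X v u s p) (hX : MinimalAperiodic X) :
    ∃ g, g ∈ Gaps X v u s p := by
  obtain ⟨k, hk⟩ := L.cLang_extend_left_gap hX L.nil_mem_cLang
  have h1 : [true] ∈ CLang X v u s p := L.cLang_infix hk ⟨[], zeros k ++ [], by simp⟩
  exact L.cLang_extend_right_gap hX h1

/-- A gap `g` always followed by `g` would put all powers of 0^g 1 into the coded language. -/
lemma not_forced_gap (L : Level X v u s p) (hX : MinimalAperiodic X) {g : ℕ}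
    (hg : g ∈ Gaps X v u s p)
    (h : ∀ k, true :: (zeros g ++ true :: (zeros k ++ [true])) ∈ CLang X v u s p → k = g) :
    False := by
  have hend : ∀ n, ∃ c, true :: wpow (zeros g ++ [true]) n = c ++ [true] := by
    intro n
    cases n with
    | zero => exact ⟨[], by simp [wpow]⟩
    | succ n => exact ⟨true :: (wpow (zeros g ++ [true]) n ++ zeros g), by
        rw [wpow_add, wpow_one]; simp⟩
  have key : ∀ n, true :: wpow (zeros g ++ [true]) (n + 1) ∈ CLang X v u s p := by
    intro n
    induction n with
    | zero => rwa [zero_add, wpow_one]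
    | succ n ih =>
      obtain ⟨k, hk⟩ := L.cLang_extend_right_gap hX ih
      obtain ⟨c, hc⟩ := hend n
      rw [wpow_add, wpow_one, ← List.cons_append, hc] at hk
      have := h k (L.cLang_infix hk ⟨c, [], by simp⟩)
      subst this
      rw [← hc] at hk
      rw [wpow_add, wpow_add, wpow_one]
      simpa using hk
  obtain ⟨N, hN⟩ := L.exists_wpow_notMem hX (c := zeros g ++ [true]) (by simp)
  refine hN (L.cLang_infix (key N) ⟨[true], zeros g ++ [true], ?_⟩)
  rw [wpow_add, wpow_one]; simp

lemma gap_of_infix (L : Level X v u s p) {c₁ c₂ : List Bool} {g : ℕ}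
    (h : c₁ ++ (true :: (zeros g ++ true :: c₂)) ∈ CLang X v u s p) : g ∈ Gaps X v u s p :=
  L.cLang_infix h ⟨c₁, c₂, by simp⟩

/-- With three gaps `r < g < h`, `r` being the least one, gaps equal to `r` alternate with the
other ones. -/
lemma gaps_alternate [Finite A] (L : Level X v u s p) (hX : MinimalAperiodic X)
    (hq : ∀ q, v.length ≤ q → 2 * complexity X q < 3 * q) {r g h : ℕ}
    (hr : r ∈ Gaps X v u s p) (hmin : ∀ k ∈ Gaps X v u s p, r ≤ k) (hrg : r < g) (hgh : g < h)
    (hg : g ∈ Gaps X v u s p) (hh : h ∈ Gaps X v u s p) {a b : ℕ}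
    (hab : true :: (zeros a ++ true :: (zeros b ++ [true])) ∈ CLang X v u s p) :
    a = r ↔ b ≠ r := by
  have hpre : ∀ c, true :: c ∈ CLang X v u s p → zeros r ++ true :: c ∈ CLang X v u s p := by
    intro c hc
    obtain ⟨k, hk⟩ := L.cLang_extend_left_gap hX hc
    obtain ⟨f, rfl⟩ := Nat.exists_eq_add_of_le
      (hmin k (L.gap_of_infix (c₁ := []) (c₂ := c) (by simpa using hk)))
    exact L.cLang_infix hk ⟨true :: zeros f, [], by
      rw [add_comm]; simp only [zeros_add, List.append_assoc, List.cons_append, List.append_nil]⟩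
  have hspec : ∀ m n, m < n → m ∈ Gaps X v u s p → n ∈ Gaps X v u s p →
      CSpecial X v u s p (zeros r ++ true :: zeros m) := by
    intro m n hmn hm hn
    refine ⟨L.cLang_infix (hpre _ hn) ?_, by simpa using hpre _ hm⟩
    obtain ⟨f, rfl⟩ := Nat.exists_eq_add_of_lt hmn
    exact ⟨[], zeros f ++ [true], by
      rw [show m + f + 1 = m + (1 + f) by ring, zeros_add, zeros_add]; simp [zeros]⟩
  -- The partner is 0^r 1 0^g, special because g < h. The maximal common suffix is 0^r, preceded by
  -- 0 in one word and by 1 in the other; g ≥ r+1 and the extra letter `y` make both words long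
  -- enough for the count.
  have hnot : ∀ y, ¬ CSpecial X v u s p (y :: (zeros r ++ true :: zeros r)) := by
    intro y hy
    have h1 := hspec g h hgh hg hh
    obtain ⟨f, rfl⟩ := Nat.exists_eq_add_of_lt hrg
    rw [show zeros r ++ true :: zeros (r + f + 1) =
      (zeros r ++ true :: zeros f) ++ false :: zeros r by
        rw [show r + f + 1 = f + (1 + r) by ring, zeros_add, zeros_add]; simp [zeros]] at h1
    refine L.not_special_pair hX hq (e := zeros r) (c₀ := zeros r ++ true :: zeros f)
      (c₁ := y :: zeros r) h1 (by simpa using hy) ?_ ?_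
    · simp
      nlinarith
    · have := L.len
      cases y <;> simp <;> nlinarith
  -- Excludes two successive gaps r: as r is not always followed by r, the word 1 0^r 1 0^r can be
  -- followed by 0, hence not also by 1.
  have h1w1 : true :: (zeros r ++ true :: zeros r) ++ [true] ∉ CLang X v u s p := by
    intro h1
    refine L.not_forced_gap hX hr fun k hk => ?_
    by_contra hne
    have hkr : r ≤ k := hmin k (L.gap_of_infix (c₁ := true :: zeros r) (c₂ := []) hk)
    obtain ⟨f, rfl⟩ := Nat.exists_eq_add_of_lt (lt_of_le_of_ne hkr (Ne.symm hne))
    refine hnot true ⟨L.cLang_infix hk ⟨[], zeros f ++ [true], ?_⟩, h1⟩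
    rw [show r + f + 1 = r + (1 + f) by ring, zeros_add, zeros_add]; simp [zeros]
  -- Excludes two successive gaps above r: 0^r 1 0^r 1 occurs and by `h1w1` is preceded by 0, so 0
  -- 0^r 1 0^r cannot also be followed by 0.
  have h0w0 : false :: (zeros r ++ true :: zeros r) ++ [false] ∉ CLang X v u s p := by
    intro h0
    have h1 := (hspec r g hrg hr hg).2
    obtain ⟨y, hy⟩ := L.cLang_extend_left hX h1
    cases y
    · exact hnot false ⟨h0, hy⟩
    · exact h1w1 hy
  have ha : r ≤ a := hmin a (L.gap_of_infix (c₁ := []) (c₂ := zeros b ++ [true]) hab)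
  have hb : r ≤ b := hmin b (L.gap_of_infix (c₁ := true :: zeros a) (c₂ := []) hab)
  constructor
  · rintro rfl rfl
    exact h1w1 (by simpa using hab)
  · intro hbr
    by_contra har
    obtain ⟨f, rfl⟩ := Nat.exists_eq_add_of_lt (lt_of_le_of_ne ha (Ne.symm har))
    obtain ⟨e, rfl⟩ := Nat.exists_eq_add_of_lt (lt_of_le_of_ne hb (Ne.symm hbr))
    refine h0w0 (L.cLang_infix hab ⟨true :: zeros f, zeros e ++ [true], ?_⟩)
    rw [show r + f + 1 = f + (1 + r) by ring, show r + e + 1 = r + (1 + e) by ring]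
    simp only [zeros_add]; simp [zeros]

/-- By alternation each gap other than r has 0^g 1 0^r 1 in front of it. So 0^g 1 0^r 1 0^g and 0^g
1 0^r 1 0^h would both be special, with maximal common suffix 0^g. -/
lemma not_four_gaps [Finite A] (L : Level X v u s p) (hX : MinimalAperiodic X)
    (hq : ∀ q, v.length ≤ q → 2 * complexity X q < 3 * q) {r g h l : ℕ}
    (hmin : ∀ k ∈ Gaps X v u s p, r ≤ k) (hmin' : ∀ k ∈ Gaps X v u s p, k ≠ r → g ≤ k)
    (hr : r ∈ Gaps X v u s p) (hg : g ∈ Gaps X v u s p) (hh : h ∈ Gaps X v u s p)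
    (hl : l ∈ Gaps X v u s p) (hrg : r < g) (hgh : g < h) (hhl : h < l) : False := by
  have halt := fun {a b} => L.gaps_alternate hX hq hr hmin hrg hgh hg hh (a := a) (b := b)
  have hpre : ∀ c k, k ≠ r → true :: (zeros k ++ true :: c) ∈ CLang X v u s p →
      zeros g ++ true :: (zeros r ++ true :: (zeros k ++ true :: c)) ∈ CLang X v u s p := by
    intro c k hk hc
    obtain ⟨m, hm⟩ := L.cLang_extend_left_gap hX hc
    have h1 : m = r := (halt (L.cLang_infix hm ⟨[], c, by simp⟩)).2 hk
    subst h1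
    obtain ⟨n, hn⟩ := L.cLang_extend_left_gap hX hm
    have h2 : n ≠ m := fun h => (halt (L.cLang_infix hn
      ⟨[], zeros k ++ true :: c, by simp⟩)).1 h rfl
    have h3 : n ∈ Gaps X v u s p := L.cLang_infix hn
      ⟨[], zeros m ++ true :: (zeros k ++ true :: c), by simp⟩
    obtain ⟨f, rfl⟩ := Nat.exists_eq_add_of_le (hmin' n h3 h2)
    exact L.cLang_infix hn ⟨true :: zeros f, [], by
      rw [add_comm]; simp only [zeros_add, List.append_assoc, List.cons_append, List.append_nil]⟩
  have hspec : ∀ m n, r < m → m < n → m ∈ Gaps X v u s p → n ∈ Gaps X v u s p →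
      CSpecial X v u s p (zeros g ++ true :: (zeros r ++ true :: zeros m)) := by
    intro m n hrm hmn hm hn
    refine ⟨L.cLang_infix (hpre [] n (by omega) hn) ?_, by simpa using hpre [] m hrm.ne' hm⟩
    obtain ⟨f, rfl⟩ := Nat.exists_eq_add_of_lt hmn
    exact ⟨[], zeros f ++ [true], by
      rw [show m + f + 1 = m + (1 + f) by ring, zeros_add, zeros_add]; simp [zeros]⟩
  have s1 := hspec g h hrg hgh hg hh
  have s0 := hspec h l (by omega) hhl hh hl
  obtain ⟨f, rfl⟩ := Nat.exists_eq_add_of_lt hgh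
  rw [show zeros g ++ true :: (zeros r ++ true :: zeros (g + f + 1)) =
    (zeros g ++ true :: (zeros r ++ true :: zeros f)) ++ false :: zeros g by
      rw [show g + f + 1 = f + (1 + g) by ring, zeros_add, zeros_add]; simp [zeros]] at s0
  rw [show zeros g ++ true :: (zeros r ++ true :: zeros g) =
    (zeros g ++ true :: zeros r) ++ true :: zeros g by simp] at s1
  have := L.len
  refine L.not_special_pair hX hq s0 s1 ?_ ?_ <;> simp <;> nlinarith

/-- There are either two gaps, or three gaps the least of which alternates with the others. -/
lemma gaps_classification [Finite A] (L : Level X v u s p) (hX : MinimalAperiodic X)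
    (hq : ∀ q, v.length ≤ q → 2 * complexity X q < 3 * q) :
    ∃ g h, g < h ∧ g ∈ Gaps X v u s p ∧
      ((∀ k, k ∈ Gaps X v u s p → k = g ∨ k = h) ∨
        ∃ r < g, (∀ k ∈ Gaps X v u s p, k = r ∨ k = g ∨ k = h) ∧
          ∀ a b, true :: (zeros a ++ true :: (zeros b ++ [true])) ∈ CLang X v u s p →
            (a = r ↔ b ≠ r)) := by
  classical
  have e1 : ∃ g, g ∈ Gaps X v u s p := L.exists_gap hX
  obtain ⟨r, hr, hmin⟩ : ∃ r ∈ Gaps X v u s p, ∀ k ∈ Gaps X v u s p, r ≤ k :=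
    ⟨Nat.find e1, Nat.find_spec e1, fun k hk => Nat.find_min' e1 hk⟩
  have e2 : ∃ g, g ∈ Gaps X v u s p ∧ g ≠ r := by
    by_contra! hc
    exact L.not_forced_gap hX hr fun k hk =>
      hc k (L.gap_of_infix (c₁ := true :: zeros r) (c₂ := []) hk)
  obtain ⟨g, ⟨hg, hgr⟩, hmin'⟩ : ∃ g, (g ∈ Gaps X v u s p ∧ g ≠ r) ∧
      ∀ k ∈ Gaps X v u s p, k ≠ r → g ≤ k :=
    ⟨Nat.find e2, Nat.find_spec e2, fun k hk hk' => Nat.find_min' e2 ⟨hk, hk'⟩⟩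
  have hrg : r < g := lt_of_le_of_ne (hmin g hg) hgr.symm
  by_cases e3 : ∃ h, h ∈ Gaps X v u s p ∧ h ≠ r ∧ h ≠ g
  · obtain ⟨h, hh, hhr, hhg⟩ := e3
    have hgh : g < h := lt_of_le_of_ne (hmin' h hh hhr) hhg.symm
    refine ⟨g, h, hgh, hg, Or.inr ⟨r, hrg, fun k hk => ?_, fun a b hab =>
      L.gaps_alternate hX hq hr hmin hrg hgh hg hh hab⟩⟩
    by_contra! hc
    have hgk : g < k := lt_of_le_of_ne (hmin' k hk hc.1) hc.2.1.symm
    rcases lt_or_gt_of_ne hc.2.2 with hkh | hkh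
    · exact L.not_four_gaps hX hq hmin hmin' hr hg hk hh hrg hgk hkh
    · exact L.not_four_gaps hX hq hmin hmin' hr hg hh hk hrg hgh hkh
  · push Not at e3
    exact ⟨r, g, hrg, hr, Or.inl fun k hk => by
      by_cases h : k = r
      · exact Or.inl h
      · exact Or.inr (e3 k hk h)⟩

/-- The next level. -/
lemma exists_next_level [Finite A] (L : Level X v u s p) (hX : MinimalAperiodic X)
    (hq : ∀ q, v.length ≤ q → 2 * complexity X q < 3 * q) :
    ∃ g h t, g < h ∧ (t = [] ∨ ∃ r < g, t = zeros r ++ [true]) ∧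
      Level X (phi v u (zeros g ++ true :: t)) (phi v u (zeros h ++ true :: t))
        (s ++ phi v u (zeros g ++ true :: t)) (phi v u (zeros g) ++ p) := by
  obtain ⟨g, h, hgh, hg, hcl⟩ := L.gaps_classification hX hq
  have hstart : ∀ k, g ≤ k → ∀ {x i c}, CAt v u s p x i (c ++ (zeros k ++ [true])) →
      CAt v u s p x i (c ++ zeros g) := by
    intro k hk x i c hc
    obtain ⟨f, rfl⟩ := Nat.exists_eq_add_of_le hk
    rw [zeros_add, List.append_assoc, ← List.append_assoc] at hc
    exact (L.cat_append.1 hc).1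
  rcases hcl with hcl | ⟨r, hr, hcl, halt⟩
  · have hext : ∀ x ∈ X, ∀ i c, CAt v u s p x i (c ++ [true]) → ∃ k, (k = g ∨ k = h) ∧
        CAt v u s p x i (c ++ true :: (zeros k ++ [true])) := by
      intro x hx i c hc
      obtain ⟨k, hk⟩ := L.extend_right_gap hX hx hc
      rw [List.append_assoc] at hk
      exact ⟨k, hcl k (L.gap_of_infix (c₁ := c) (c₂ := []) (mem_cLang.2 ⟨x, hx, i, hk⟩)), hk⟩
    have hext' : ∀ x ∈ X, ∀ i c, CAt v u s p x i (c ++ [true]) →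
        CAt v u s p x i (c ++ [true] ++ zeros g) := by
      intro x hx i c hc
      obtain ⟨k, hk, hk'⟩ := hext x hx i c hc
      exact hstart k (by omega) (by simpa using hk')
    refine ⟨g, h, [], hgh, Or.inl rfl, L.derive hgh (Or.inl rfl) ?_ ?_⟩
    · obtain ⟨x, hx, i, hi⟩ := mem_cLang.1 hg
      have := hext' x hx i (true :: zeros g) (by simpa using hi)
      exact L.cLang_infix (mem_cLang.2 ⟨x, hx, i, this⟩) ⟨[true], [], by simp⟩
    · intro x hx i hi
      obtain ⟨k, hk, hk'⟩ := hext x hx i (zeros g) (L.cat_append.1 hi).1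
      exact ⟨k, hk, by simpa using hext' x hx i (zeros g ++ true :: zeros k) (by simpa using hk')⟩
  -- With three gaps, r is followed by g or h (`hA`) and any other gap by r (`hB`), so t = 0^r 1
  -- closes every block.
  · have hA : ∀ x ∈ X, ∀ i c a, CAt v u s p x i (c ++ true :: (zeros a ++ [true])) → a = r →
        ∃ k, (k = g ∨ k = h) ∧
          CAt v u s p x i (c ++ true :: (zeros a ++ true :: (zeros k ++ [true]))) := by
      intro x hx i c a hc ha
      obtain ⟨k, hk⟩ := L.extend_right_gap hX hx hc
      have hk : CAt v u s p x i (c ++ true :: (zeros a ++ true :: (zeros k ++ [true]))) := by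
        simpa using hk
      have h1 := mem_cLang.2 ⟨x, hx, i, hk⟩
      have h2 := (halt a k (L.cLang_infix h1 ⟨c, [], by simp⟩)).1 ha
      exact ⟨k, (hcl k (L.gap_of_infix (c₁ := c ++ true :: zeros a) (c₂ := [])
        (by simpa using h1))).resolve_left h2, hk⟩
    have hB : ∀ x ∈ X, ∀ i c a, CAt v u s p x i (c ++ true :: (zeros a ++ [true])) → a ≠ r →
        CAt v u s p x i (c ++ true :: (zeros a ++ true :: (zeros r ++ [true]))) := by
      intro x hx i c a hc ha
      obtain ⟨k, hk⟩ := L.extend_right_gap hX hx hc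
      have hk : CAt v u s p x i (c ++ true :: (zeros a ++ true :: (zeros k ++ [true]))) := by
        simpa using hk
      have h1 := mem_cLang.2 ⟨x, hx, i, hk⟩
      have h2 : k = r := by
        by_contra h3
        exact ha ((halt a k (L.cLang_infix h1 ⟨c, [], by simp⟩)).2 h3)
      exact h2 ▸ hk
    have hC : ∀ x ∈ X, ∀ i c, CAt v u s p x i (c ++ true :: (zeros r ++ [true])) →
        CAt v u s p x i (c ++ true :: (zeros r ++ [true]) ++ zeros g) := by
      intro x hx i c hc
      obtain ⟨k, hk, hk'⟩ := hA x hx i c r hc rfl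
      exact hstart k (by omega) (by simpa using hk')
    refine ⟨g, h, zeros r ++ [true], hgh, Or.inr ⟨r, hr, rfl⟩,
      L.derive hgh (Or.inr ⟨r, hr, rfl⟩) ?_ ?_⟩
    · obtain ⟨x, hx, i, hi⟩ := mem_cLang.1 hg
      have h1 := hB x hx i [] g (by simpa using hi) hr.ne'
      have h2 := hC x hx i (true :: zeros g) (by simpa using h1)
      exact L.cLang_infix (mem_cLang.2 ⟨x, hx, i, h2⟩) ⟨[true], [], by simp⟩
    · intro x hx i hi
      obtain ⟨k, hk, h1⟩ := hA x hx i (zeros g) r (L.cat_append.1 hi).1 rfl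
      have h2 := hB x hx i (zeros g ++ true :: zeros r) k (by simpa using h1) (by omega)
      have h3 := hC x hx i (zeros g ++ true :: (zeros r ++ true :: zeros k)) (by simpa using h2)
      exact ⟨k, hk, by simpa using h3⟩

end Level

end Gaps

/-! ### The first level, from return words -/

section Initial

variable {A : Type*} {X : Set (ℤ → A)}

/-- Growth by at least 2 at all lengths from `n₀` on would beat 3q/2 at q = 4n₀ + q₀. -/
lemma exists_complexity_succ_eq (hX : MinimalAperiodic X) [Finite A] {q₀ : ℕ}
    (hq : ∀ q, q₀ ≤ q → 2 * complexity X q < 3 * q) (n₀ : ℕ) :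
    ∃ n, n₀ ≤ n ∧ complexity X (n + 1) = complexity X n + 1 := by
  by_contra! hc
  have key : ∀ k, 2 * k ≤ complexity X (n₀ + k) := by
    intro k
    induction k with
    | zero => simp
    | succ k ih =>
      have h1 := hc (n₀ + k) (by omega)
      have h2 := hX.complexity_succ_le (n₀ + k)
      rw [← add_assoc]
      omega
  have h1 := key (3 * n₀ + q₀)
  have h2 := hq (n₀ + (3 * n₀ + q₀)) (by omega)
  omega

/-- An occurrence of `w` in `x` ends at `i`. -/
def EndsAt (w : List A) (x : ℤ → A) (i : ℤ) : Prop := At x (i - w.length) w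

/-- The sequence `x` around `i` and the sequence `y` around `j` agree from `-m` to `k - 1`. -/
def Agree (x y : ℤ → A) (i j m k : ℤ) : Prop := ∀ l, -m ≤ l → l < k → x (i + l) = y (j + l)

lemma endsAt_congr {w : List A} {x y : ℤ → A} {i j : ℤ}
    (h : ∀ l : ℤ, -(w.length : ℤ) ≤ l → l < 0 → x (i + l) = y (j + l)) :
    EndsAt w x i ↔ EndsAt w y j := by
  have : block x (i - w.length) w.length = block y (j - w.length) w.length := by
    rw [block_eq_block_iff]
    intro l hl
    have := h (l - w.length) (by omega) (by omega)
    convert this using 2 <;> ring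
  unfold EndsAt At
  rw [this]

lemma EndsAt.eq {w : List A} {x y : ℤ → A} {i j : ℤ} (hx : EndsAt w x i) (hy : EndsAt w y j)
    {l : ℤ} (h1 : -(w.length : ℤ) ≤ l) (h2 : l < 0) : x (i + l) = y (j + l) := by
  have hb : block x (i - w.length) w.length = block y (j - w.length) w.length := by
    unfold EndsAt At at hx hy
    rw [hx, hy]
  have := block_eq_block_iff.1 hb (l + w.length).toNat (by omega)
  convert this using 2 <;> omega

lemma Agree.endsAt_iff {w : List A} {x y : ℤ → A} {i j k : ℤ}
    (h : Agree x y i j w.length k) {l : ℤ} (h0 : 0 ≤ l) (hl : l ≤ k) :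
    EndsAt w x (i + l) ↔ EndsAt w y (j + l) := by
  refine endsAt_congr fun m h1 h2 => ?_
  have := h (l + m) (by omega) (by omega)
  convert this using 2 <;> ring

/-- After an agreement of length `|w|`, sequences agree as long as the only right special word
`w` is not met. -/
lemma Agree.extend {w : List A}
    (huniq : ∀ w' a b, w'.length = w.length → RightSpecial X w' a b → w' = w)
    {x y : ℤ → A} (hx : x ∈ X) (hy : y ∈ X) {i j : ℤ} {r : ℤ} (hr : 0 ≤ r)
    (h : Agree x y i j w.length r) {T : ℤ} (hT : ∀ l, r ≤ l → l < T → ¬ EndsAt w x (i + l)) :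
    Agree x y i j w.length T := by
  have key : ∀ k : ℕ, r + k ≤ T → Agree x y i j w.length (r + k) := by
    intro k
    induction k with
    | zero => intro _; simpa using h
    | succ k ih =>
      intro hk
      push_cast at hk
      have ih := ih (by omega)
      intro l h1 h2
      push_cast at h2
      rcases eq_or_lt_of_le (show l ≤ r + k by omega) with rfl | h3
      · by_contra hne
        have hb : block x (i + (r + k) - w.length) w.length =
            block y (j + (r + k) - w.length) w.length := by
          rw [block_eq_block_iff]
          intro l hl
          have := ih (r + k - w.length + l) (by omega) (by omega)
          convert this using 2 <;> ring
        have hL : ∀ z ∈ X, ∀ m : ℤ, block z (m - w.length) w.length ++ [z m] ∈ Lang X :=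
          fun z hz m => ⟨z, hz, m - w.length, at_append.2 ⟨by simp, by simp⟩⟩
        have h4 := huniq _ _ _ (by simp) (⟨hne, hL x hx _, hb ▸ hL y hy _⟩ : RightSpecial X _ _ _)
        exact hT (r + k) (by omega) (by omega) h4
      · exact ih l h1 h3
  intro l h1 h2
  rcases lt_or_ge l r with h3 | h3
  · exact h l h1 h3
  · exact key (l - r + 1).toNat (by omega) l h1 (by omega)

lemma exists_next_endsAt (hX : MinimalAperiodic X) {w : List A} (hw : w ∈ Lang X) {x : ℤ → A}
    (hx : x ∈ X) (i : ℤ) :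
    ∃ R : ℕ, 0 < R ∧ EndsAt w x (i + R) ∧ ∀ l, 0 < l → l < (R : ℤ) → ¬ EndsAt w x (i + l) := by
  classical
  obtain ⟨N, hN⟩ := hX.recurrent w hw
  obtain ⟨k, h1, -, h3⟩ := hN x hx (i + 1)
  have h4 : ∃ R : ℕ, 0 < R ∧ EndsAt w x (i + R) := by
    refine ⟨(k + w.length - i).toNat, by omega, ?_⟩
    unfold EndsAt
    convert h3 using 1
    omega
  refine ⟨Nat.find h4, (Nat.find_spec h4).1, (Nat.find_spec h4).2, fun l hl hl' hc => ?_⟩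
  refine Nat.find_min h4 (m := l.toNat) (by omega) ⟨by omega, ?_⟩
  rwa [Int.toNat_of_nonneg hl.le]

lemma exists_prev_endsAt (hX : MinimalAperiodic X) {w : List A} (hw : w ∈ Lang X) {x : ℤ → A}
    (hx : x ∈ X) (i : ℤ) :
    ∃ j < i, EndsAt w x j ∧ ∀ k, j < k → k < i → ¬ EndsAt w x k := by
  obtain ⟨N, hN⟩ := hX.recurrent w hw
  obtain ⟨k, -, h2, h3⟩ := hN x hx (i - 1 - N - w.length)
  obtain ⟨j, ⟨h4, h5⟩, h6⟩ := Int.exists_greatest_of_bdd (P := fun j => j < i ∧ EndsAt w x j)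
    ⟨i, fun z hz => hz.1.le⟩ ⟨k + w.length, by omega, by
      unfold EndsAt; rwa [add_sub_cancel_right]⟩
  exact ⟨j, h4, h5, fun k hk hk' hc => by have := h6 k ⟨hk', hc⟩; omega⟩

/-- The first return to the only right special word `w` is determined by the next letter. -/
lemma exists_return (hX : MinimalAperiodic X) {w : List A}
    (huniq : ∀ w' a b, w'.length = w.length → RightSpecial X w' a b → w' = w)
    {x : ℤ → A} (hx : x ∈ X) {i : ℤ} (hi : EndsAt w x i) :
    ∃ R : ℕ, 0 < R ∧ ∀ y ∈ X, ∀ j, EndsAt w y j → y j = x i →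
      Agree x y i j w.length R ∧ EndsAt w y (j + R) ∧
        ∀ l, 0 < l → l < (R : ℤ) → ¬ EndsAt w y (j + l) := by
  obtain ⟨R, h0, h1, h2⟩ := exists_next_endsAt hX ⟨x, hx, _, hi⟩ hx i
  refine ⟨R, h0, fun y hy j hj hc => ?_⟩
  have h3 : Agree x y i j w.length 1 := by
    intro l h4 h5
    rcases eq_or_lt_of_le (show l ≤ 0 by omega) with rfl | h6
    · simpa using hc.symm
    · exact hi.eq hj h4 h6
  have h4 := h3.extend huniq hx hy (by norm_num) (T := R) (fun l h5 h6 => h2 l (by omega) h6)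
  exact ⟨h4, (h4.endsAt_iff (by omega) le_rfl).1 h1, fun l h5 h6 h7 =>
    h2 l h5 h6 ((h4.endsAt_iff h5.le h6.le).2 h7)⟩

/-- The common past of all occurrences of `w` is finite. -/
lemma exists_max_past (hX : MinimalAperiodic X) {w : List A} (hw : w ∈ Lang X) :
    ∃ N : ℕ, w.length ≤ N ∧
      (∀ x ∈ X, ∀ y ∈ X, ∀ i j, EndsAt w x i → EndsAt w y j →
        ∀ l, -(N : ℤ) ≤ l → l < 0 → x (i + l) = y (j + l)) ∧
      ¬ (∀ x ∈ X, ∀ y ∈ X, ∀ i j, EndsAt w x i → EndsAt w y j →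
        x (i + (-(N : ℤ) - 1)) = y (j + (-(N : ℤ) - 1))) := by
  classical
  let P : ℕ → Prop := fun N => ¬ ∀ x ∈ X, ∀ y ∈ X, ∀ i j, EndsAt w x i → EndsAt w y j →
    ∀ l, -(N : ℤ) ≤ l → l < 0 → x (i + l) = y (j + l)
  -- If the common past were infinite, the distance `R` between two successive occurrences would be
  -- a period of arbitrarily long stretches.
  have hP : ∃ N, P N := by
    obtain ⟨x, hx⟩ := hX.nonempty
    obtain ⟨i, -, hi, -⟩ := exists_prev_endsAt hX hw hx 0
    obtain ⟨R, h0, h1, -⟩ := exists_next_endsAt hX hw hx i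
    obtain ⟨n, hn⟩ := hX.aperiodic R h0
    obtain ⟨l, hl, hne⟩ := hn x hx (i - n)
    refine ⟨n, fun h => hne ?_⟩
    have := h x hx x hx i (i + R) hi h1 (l - n) (by omega) (by omega)
    convert this using 2 <;> ring
  have hspec : P (Nat.find hP) := Nat.find_spec hP
  have hlt : w.length < Nat.find hP := by
    by_contra! hle
    exact hspec fun x _ y _ i j hi hj l h1 h2 => hi.eq hj (by omega) h2
  have hmin := Nat.find_min hP (m := Nat.find hP - 1) (by omega)
  simp only [P, not_not] at hmin
  refine ⟨Nat.find hP - 1, by omega, hmin, fun h => hspec ?_⟩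
  intro x hx y hy i j hi hj l h1 h2
  rcases eq_or_lt_of_le h1 with h3 | h3
  · have := h x hx y hy i j hi hj
    convert this using 2 <;> omega
  · exact hmin x hx y hy i j hi hj l (by omega) h2

lemma window_card_le {n N : ℕ} [Finite A] (f : Fin n → List A) (hf : Function.Injective f)
    (hfm : ∀ l, f l ∈ languageOfLength X N) : n ≤ complexity X N := by
  classical
  have h := Set.ncard_le_ncard (s := ↑(Finset.univ.image f)) (t := languageOfLength X N)
    (by intro z hz; simp at hz; obtain ⟨l, rfl⟩ := hz; exact hfm l)
    (finite_languageOfLength X N)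
  rw [Set.ncard_coe_finset, Finset.card_image_of_injective _ hf] at h
  simpa [complexity] using h

/-- There are long words `W` with exactly two return words. -/
lemma exists_return_words [Finite A] (hX : MinimalAperiodic X) {q₀ : ℕ}
    (hq : ∀ q, q₀ ≤ q → 2 * complexity X q < 3 * q) (n₀ : ℕ) :
    ∃ (W v u : List A), n₀ ≤ W.length ∧ W ∈ Lang X ∧
      (∃ a b, a ≠ b ∧ [a] <+: v ∧ [b] <+: u) ∧
      (∃ c d, c ≠ d ∧ c :: W <:+ W ++ v ∧ d :: W <:+ W ++ u) ∧
      W ++ v ∈ Lang X ∧ W ++ u ∈ Lang X ∧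
      (∀ x ∈ X, ∀ i, Cut W [] x i →
        (At x i v ∧ Cut W [] x (i + v.length) ∧
          ∀ j, i < j → j < i + v.length → ¬ Cut W [] x j) ∨
        (At x i u ∧ Cut W [] x (i + u.length) ∧
          ∀ j, i < j → j < i + u.length → ¬ Cut W [] x j)) ∧
      (v.length ≤ W.length ∨ u.length ≤ W.length) := by
  obtain ⟨n, hn, hpn⟩ := exists_complexity_succ_eq hX hq (max n₀ q₀)
  obtain ⟨w, a, b, rfl, hw⟩ := hX.exists_rightSpecial n
  have huniq : ∀ w' a b, w'.length = w.length → RightSpecial X w' a b → w' = w := by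
    intro w' a' b' hl h'
    by_contra hne
    have := hw.add_two_le h' hl.symm (Ne.symm hne)
    omega
  have htwo : ∀ c, w ++ [c] ∈ Lang X → c = a ∨ c = b := by
    intro c hc
    by_contra! hne
    have := hw.add_two_le_of_three hc hne.1 hne.2
    omega
  have hwL : w ∈ Lang X := lang_of_infix hw.2.1 ⟨[], [a], by simp⟩
  have hocc : ∀ c, w ++ [c] ∈ Lang X → ∃ x ∈ X, ∃ i, EndsAt w x i ∧ x i = c := by
    rintro c ⟨x, hx, i, hi⟩
    obtain ⟨h1, h2⟩ := at_append.1 hi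
    exact ⟨x, hx, i + w.length, by unfold EndsAt; rwa [add_sub_cancel_right], by simpa using h2⟩
  obtain ⟨x, hx, i, hi, rfl⟩ := hocc a hw.2.1
  obtain ⟨y, hy, j, hj, rfl⟩ := hocc b hw.2.2
  obtain ⟨R, hR, hret⟩ := exists_return hX huniq hx hi
  obtain ⟨S, hS, hret'⟩ := exists_return hX huniq hy hj
  obtain ⟨N, hwN, hcom, hmax⟩ := exists_max_past hX hwL
  -- The block W of length `N` before `i` ends with `w` and lies in the common past of all
  -- occurrences of `w`, so W and `w` end at the same places.
  have hends : ∀ z ∈ X, ∀ k, Cut (block x (i - N) N) [] z k ↔ EndsAt w z k := by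
    intro z hz k
    rw [cut_iff]
    simp only [length_block, at_nil, and_true]
    have hb : At z (k - N) (block x (i - N) N) ↔ ∀ l < N, z (k - N + (l : ℕ)) = x (i - N + (l : ℕ)) := by
      unfold At
      rw [length_block, block_eq_block_iff]
    rw [hb]
    constructor
    · intro h
      refine (endsAt_congr fun l h1 h2 => ?_).2 hi
      have := h (l + N).toNat (by omega)
      convert this using 2 <;> omega
    · intro h l hl
      have := hcom z hz x hx k i h hi (l - N) (by omega) (by omega)
      convert this using 2 <;> ring
  have hagree : ∀ z ∈ X, ∀ k, EndsAt w z k → z k = x i → Agree x z i k N R := by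
    intro z hz k hk hzk l h1 h2
    rcases lt_or_ge l 0 with h3 | h3
    · exact hcom x hx z hz i k hi hk l h1 h3
    · exact (hret z hz k hk hzk).1 l (by omega) h2
  have hagree' : ∀ z ∈ X, ∀ k, EndsAt w z k → z k = y j → Agree y z j k N S := by
    intro z hz k hk hzk l h1 h2
    rcases lt_or_ge l 0 with h3 | h3
    · exact hcom y hy z hz j k hj hk l h1 h3
    · exact (hret' z hz k hk hzk).1 l (by omega) h2
  have hletter : ∀ z ∈ X, ∀ k, EndsAt w z k → z k = x i ∨ z k = y j := by
    intro z hz k hk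
    exact htwo _ ⟨z, hz, k - w.length, at_append.2 ⟨hk, by simp⟩⟩
  -- Every occurrence of `w` ends one of the two returns. Were these letters equal, the common past
  -- would be longer than `N`.
  have hleft : x (i + (R - N - 1)) ≠ y (j + (S - N - 1)) := by
    intro he
    apply hmax
    have hall : ∀ z ∈ X, ∀ k, EndsAt w z k → z (k + (-(N : ℤ) - 1)) = x (i + (R - N - 1)) := by
      intro z hz k hk
      obtain ⟨m, hm, h1, h2⟩ := exists_prev_endsAt hX hwL hz k
      have hlast : ∀ T : ℕ, 0 < T → EndsAt w z (m + T) →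
          (∀ l, 0 < l → l < (T : ℤ) → ¬ EndsAt w z (m + l)) → k = m + T := by
        intro T hT h3 h4
        rcases lt_trichotomy k (m + T) with h5 | h5 | h5
        · exact absurd (by rwa [add_sub_cancel]) (h4 (k - m) (by omega) (by omega))
        · exact h5
        · exact absurd h3 (h2 _ (by omega) h5)
      rcases hletter z hz m h1 with h3 | h3
      · obtain ⟨-, h4, h5⟩ := hret z hz m h1 h3
        rw [hlast R hR h4 h5, hagree z hz m h1 h3 (R - N - 1) (by omega) (by omega)]
        congr 1; ring
      · obtain ⟨-, h4, h5⟩ := hret' z hz m h1 h3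
        rw [he, hlast S hS h4 h5, hagree' z hz m h1 h3 (S - N - 1) (by omega) (by omega)]
        congr 1; ring
    intro z hz z' hz' k k' hk hk'
    rw [hall z hz k hk, hall z' hz' k' hk']
  have hRx := (hret x hx i hi rfl)
  have hSy := (hret' y hy j hj rfl)
  have hcatx : ∀ (z : ℤ → A) (k : ℤ) (T : ℕ), At z (k - N) (block x (i - N) N) →
      At z (k - N) (block x (i - N) N ++ block z k T) := by
    intro z k T h
    refine at_append.2 ⟨h, ?_⟩
    rw [length_block, sub_add_cancel]; simp
  have hWx : At x (i - N) (block x (i - N) N) := by simp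
  have hWy : At y (j - N) (block x (i - N) N) := by
    have := (cut_iff.1 ((hends y hy j).2 hj)).1
    rwa [length_block] at this
  have hsuf : ∀ z ∈ X, ∀ (k : ℤ) (T : ℕ), 0 < T → EndsAt w z k → EndsAt w z (k + T) →
      z (k + (T - N - 1)) :: block x (i - N) N <:+ block x (i - N) N ++ block z k T := by
    intro z hz k T hT h1 h2
    have h3 := (cut_iff.1 ((hends z hz _).2 h1)).1
    have h4 := (cut_iff.1 ((hends z hz _).2 h2)).1
    rw [length_block] at h3 h4
    have h5 := hcatx z k T h3
    have h6 : At z (k + (T - N - 1)) (z (k + (T - N - 1)) :: block x (i - N) N) := by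
      rw [← List.singleton_append, at_append]
      refine ⟨by simp, ?_⟩
      convert h4 using 1
      simp; ring
    exact h6.suffix_of_le h5 (by simp; ring) (by simp; omega)
  refine ⟨block x (i - N) N, block x i R, block y j S, ?_, ⟨x, hx, _, hWx⟩,
    ⟨x i, y j, hw.1, ?_, ?_⟩, ⟨_, _, hleft, ?_, ?_⟩, ⟨x, hx, _, hcatx x i R hWx⟩,
    ⟨y, hy, _, hcatx y j S hWy⟩, ?_, ?_⟩
  · rw [length_block]
    have := le_max_left n₀ q₀
    omega
  · exact At.prefix_of_le (x := x) (i := i) (by simp) (by simp) (by simp; omega)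
  · exact At.prefix_of_le (x := y) (i := j) (by simp) (by simp) (by simp; omega)
  · exact hsuf x hx i R hR hi hRx.2.1
  · exact hsuf y hy j S hS hj hSy.2.1
  · intro z hz k hk
    rw [hends z hz] at hk
    have hat : ∀ (z' : ℤ → A) (k' : ℤ) (T : ℕ), Agree z' z k' k N T → At z k (block z' k' T) := by
      intro z' k' T h
      unfold At
      rw [length_block, block_eq_block_iff]
      exact fun l hl => (h l (by omega) (by omega)).symm
    simp only [length_block]
    have hno : ∀ T : ℕ, (∀ l, 0 < l → l < (T : ℤ) → ¬ EndsAt w z (k + l)) →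
        ∀ m, k < m → m < k + T → ¬ Cut (block x (i - N) N) [] z m := by
      intro T h m h1 h2
      rw [hends z hz]
      have := h (m - k) (by omega) (by omega)
      rwa [add_sub_cancel] at this
    rcases hletter z hz k hk with h3 | h3
    · obtain ⟨-, h4, h5⟩ := hret z hz k hk h3
      exact Or.inl ⟨hat x i R (hagree z hz k hk h3), (hends z hz _).2 h4, hno R h5⟩
    · obtain ⟨-, h4, h5⟩ := hret' z hz k hk h3
      exact Or.inr ⟨hat y j S (hagree' z hz k hk h3), (hends z hz _).2 h4, hno S h5⟩
  · simp only [length_block]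
    by_contra! hlong
    -- After equal windows at inner positions of two returns the sequences agree until `w` is met
    -- again. So the remaining times coincide, and so do the letters in front of the next W.
    have hsync : ∀ z ∈ X, ∀ z' ∈ X, ∀ (k k' : ℤ) (T T' : ℕ), EndsAt w z (k + T) →
        (∀ l, 0 < l → l < (T : ℤ) → ¬ EndsAt w z (k + l)) → EndsAt w z' (k' + T') →
        (∀ l, 0 < l → l < (T' : ℤ) → ¬ EndsAt w z' (k' + l)) →
        ∀ l l' : ℕ, 0 < l → 0 < l' → l < T → l' < T' →
        block z (k + l - N) N = block z' (k' + l' - N) N →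
        (T : ℤ) - l = T' - l' ∧ z (k + (T - N - 1)) = z' (k' + (T' - N - 1)) := by
      intro z hz z' hz' k k' T T' h1 h2 h1' h2' l l' hl hl' hlT hlT' he
      have ha : Agree z z' (k + l) (k' + l') N 0 := by
        intro m h3 h4
        have := block_eq_block_iff.1 he (m + N).toNat (by omega)
        convert this using 2 <;> omega
      have ha' : Agree z z' (k + l) (k' + l') w.length 0 := fun m h3 h4 => ha m (by omega) h4
      have hb := ha'.extend huniq hz hz' le_rfl (T := T - l) (by
        intro m h3 h4
        rw [add_assoc]
        exact h2 _ (by omega) (by omega))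
      have h3 : EndsAt w z' (k' + (l' + (T - l))) := by
        have := (hb.endsAt_iff (l := T - l) (by omega) le_rfl).1 (by
          convert h1 using 1; ring)
        convert this using 1; ring
      have h4 : (T : ℤ) - l = T' - l' := by
        rcases lt_trichotomy ((T : ℤ) - l) (T' - l') with h5 | h5 | h5
        · exact absurd h3 (h2' _ (by omega) (by omega))
        · exact h5
        · have h6 := (hb.endsAt_iff (l := T' - l') (by omega) h5.le).2 (by
            convert h1' using 1; ring)
          rw [add_assoc] at h6
          exact absurd h6 (h2 _ (by omega) (by omega))
      refine ⟨h4, ?_⟩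
      have h5 : z (k + l + (T - l - N - 1)) = z' (k' + l' + (T - l - N - 1)) := by
        rcases lt_or_ge ((T : ℤ) - l - N - 1) 0 with h6 | h6
        · exact ha _ (by omega) h6
        · exact hb _ (by omega) (by omega)
      convert h5 using 2
      · ring
      · linarith
    have hzero : ∀ z ∈ X, ∀ z' ∈ X, ∀ (k k' : ℤ) (l' : ℕ), EndsAt w z k →
        block z (k - N) N = block z' (k' + l' - N) N → EndsAt w z' (k' + l') := by
      intro z hz z' hz' k k' l' h1 he
      refine (endsAt_congr fun m h3 h4 => ?_).1 h1
      have := block_eq_block_iff.1 he (m + N).toNat (by omega)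
      convert this using 2 <;> omega
    -- Windows of length `N` ending just before `i, ..., i + N` in `x` and `j + 1, ..., j + N` in
    -- `y`. The one before `j` is left out, being W again.
    let f : Fin (N + 1 + N) → List A := fun m =>
      if (m : ℕ) ≤ N then block x (i + (m : ℕ) - N) N
      else block y (j + ((m : ℕ) - N : ℕ) - N) N
    have hf : Function.Injective f := by
      intro m m' hmm
      wlog hle : m ≤ m' generalizing m m'
      · exact (this hmm.symm (le_of_not_ge hle)).symm
      have hm := m.2
      have hm' := m'.2
      simp only [f] at hmm
      apply Fin.ext
      have hle' : (m : ℕ) ≤ m' := hle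
      split_ifs at hmm with h1 h2 h2
      · rcases Nat.eq_zero_or_pos (m : ℕ) with h0 | h0
        · rw [h0] at hmm
          have h3 := hzero x hx x hx i i m' hi (by simpa using hmm)
          by_contra h4
          exact hRx.2.2 m' (by omega) (by omega) h3
        · have := (hsync x hx x hx i i R R hRx.2.1 hRx.2.2 hRx.2.1 hRx.2.2 m m' h0
            (by omega) (by omega) (by omega) hmm).1
          omega
      · exfalso
        rcases Nat.eq_zero_or_pos (m : ℕ) with h0 | h0
        · rw [h0] at hmm
          have h3 := hzero x hx y hy i j _ hi (by simpa using hmm)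
          exact hSy.2.2 _ (by omega) (by omega) h3
        · exact hleft (hsync x hx y hy i j R S hRx.2.1 hRx.2.2 hSy.2.1 hSy.2.2 m _ h0
            (by omega) (by omega) (by omega) hmm).2
      · omega
      · have := (hsync y hy y hy j j S S hSy.2.1 hSy.2.2 hSy.2.1 hSy.2.2 _ _
          (by omega) (by omega) (by omega) (by omega) hmm).1
        omega
    have hfm : ∀ l, f l ∈ languageOfLength X N := by
      intro l
      simp only [f]
      split_ifs
      · exact ⟨x, hx, _, rfl⟩
      · exact ⟨y, hy, _, rfl⟩
    have h1 := window_card_le f hf hfm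
    have h2 := hq N (by have := le_max_right n₀ q₀; omega)
    omega

/-- The shorter word `v` is a suffix of `W`, hence of `u`. If |W| ≥ |v|+|u|, then both `u ++ v` and
`v ++ u` would be suffixes of `W` and so equal, although `v` and `u` begin with different letters.
-/
lemma level_of_return_words {W v u : List A} (hW : W ∈ Lang X)
    (hab : ∃ a b, a ≠ b ∧ [a] <+: v ∧ [b] <+: u)
    (hcd : ∃ c d, c ≠ d ∧ c :: W <:+ W ++ v ∧ d :: W <:+ W ++ u)
    (hnext : ∀ x ∈ X, ∀ i, Cut W [] x i →
        (At x i v ∧ Cut W [] x (i + v.length) ∧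
          ∀ j, i < j → j < i + v.length → ¬ Cut W [] x j) ∨
        (At x i u ∧ Cut W [] x (i + u.length) ∧
          ∀ j, i < j → j < i + u.length → ¬ Cut W [] x j))
    (hvW : v.length ≤ W.length) (hvu : v.length ≤ u.length) : Level X v u W [] := by
  obtain ⟨a, b, hne, ha, hb⟩ := hab
  obtain ⟨c, d, hcd', hc, hd⟩ := hcd
  have hWv : W <:+ W ++ v := (List.suffix_cons _ _).trans hc
  have hWu : W <:+ W ++ u := (List.suffix_cons _ _).trans hd
  have hvW' : v <:+ W := List.suffix_of_suffix_length_le (List.suffix_append _ _) hWv hvW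
  have hsuf : v <:+ u :=
    List.suffix_of_suffix_length_le (hvW'.trans hWu) (List.suffix_append _ _) hvu
  have hhead : ∀ z z' : List A, v ++ z ≠ u ++ z' := by
    intro z z' he
    have h1 : [a] <+: u ++ z' := he ▸ ha.trans (List.prefix_append _ _)
    have h2 : [b] <+: u ++ z' := hb.trans (List.prefix_append _ _)
    have h3 := (List.prefix_of_prefix_length_le h1 h2 (by simp)).eq_of_length (by simp)
    simp at h3
    exact hne h3
  have hlt : v.length < u.length := by
    refine lt_of_le_of_ne hvu fun he => hhead [] [] ?_
    rw [hsuf.eq_of_length he]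
  refine ⟨hlt, hsuf, ⟨a, b, hne, by simpa using ha, by simpa using hb⟩,
    ⟨c, d, hcd', hc, hd⟩, ?_, by simpa using hW, hnext⟩
  by_contra hlong
  simp only [List.length_nil, zero_add, not_lt] at hlong
  have huW : u <:+ W :=
    List.suffix_of_suffix_length_le (List.suffix_append _ _) hWu (by omega)
  have h1 : u ++ v <:+ W ++ v := (List.suffix_append_self_iff (l₃ := v)).2 huW
  have h2 : v ++ u <:+ W ++ u := (List.suffix_append_self_iff (l₃ := u)).2 hvW'
  have h3 : u ++ v <:+ W := List.suffix_of_suffix_length_le h1 hWv (by simp; omega)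
  have h4 : v ++ u <:+ W := List.suffix_of_suffix_length_le h2 hWu (by simp; omega)
  have h5 := (List.suffix_of_suffix_length_le h3 h4 (by simp; omega)).eq_of_length
    (by simp; omega)
  exact hhead u v h5.symm

lemma exists_initial_level [Finite A] (hX : MinimalAperiodic X) {q₀ : ℕ}
    (hq : ∀ q, q₀ ≤ q → 2 * complexity X q < 3 * q) (Q : ℕ) :
    ∃ v u s, Level X v u s [] ∧ Q ≤ v.length := by
  obtain ⟨n, hn⟩ := hX.exists_period_bound Q
  obtain ⟨W, v, u, hWn, hW, ⟨a, b, hab, ha, hb⟩, ⟨c, d, hcd, hc, hd⟩, hv, hu, hnext, hlen⟩ :=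
    exists_return_words hX hq n
  -- `W` occurs again |z| places later, so |z| is a period along `W`, which is too long for a period
  -- below `Q`.
  have hlong : ∀ z : List A, 0 < z.length → W ++ z ∈ Lang X → W <:+ W ++ z → Q ≤ z.length := by
    rintro z hz ⟨x, hx, i, hi⟩ hs
    by_contra! hlt
    obtain ⟨l, hl, hne⟩ := hn _ hz hlt x hx i
    apply hne
    have h1 := (at_append.1 hi).1
    have h2 := hi.of_suffix hs (j := i + z.length) (by push_cast [List.length_append]; ring)
    rw [at_iff.1 h1 l (by omega), ← at_iff.1 h2 l (by omega)]
    congr 1; ring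
  have hvpos : 0 < v.length := ha.length_le
  have hupos : 0 < u.length := hb.length_le
  rcases le_total v.length u.length with hvu | hvu
  · exact ⟨v, u, W, level_of_return_words hW ⟨a, b, hab, ha, hb⟩ ⟨c, d, hcd, hc, hd⟩ hnext
      (by omega) hvu, hlong v hvpos hv ((List.suffix_cons _ _).trans hc)⟩
  · exact ⟨u, v, W, level_of_return_words hW ⟨b, a, hab.symm, hb, ha⟩ ⟨d, c, hcd.symm, hd, hc⟩
      (fun x hx i hi => (hnext x hx i hi).symm) (by omega) hvu,
      hlong u hupos hu ((List.suffix_cons _ _).trans hd)⟩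

end Initial

/-! ### Maximal prefixes and suffixes, unique decomposition, one recursion step -/

section Words

variable {A : Type*} {X : Set (ℤ → A)} {v u s p : List A}

namespace Level

lemma isMaxCommonPrefix (L : Level X v u s p) : IsMaxCommonPrefix u v p := by
  refine ⟨L.p_prefix_u, L.p_prefix_v, fun w hu hv => ?_⟩
  rcases le_or_gt w.length p.length with h | h
  · exact List.prefix_of_prefix_length_le hu L.p_prefix_u h
  · exfalso
    obtain ⟨a, b, hab, ha, hb⟩ := L.pre
    have h1 := List.prefix_of_prefix_length_le ha hv (by simpa using h)
    have h2 := List.prefix_of_prefix_length_le hb hu (by simpa using h)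
    have h3 := (List.prefix_of_prefix_length_le h1 h2 (by simp)).eq_of_length (by simp)
    simp at h3
    exact hab h3

lemma append_ne (L : Level X v u s p) (z z' : List A) : v ++ z ≠ u ++ z' := by
  intro h
  obtain ⟨a, b, hab, ha, hb⟩ := L.pre
  have h1 : p ++ [a] <+: u ++ z' := h ▸ ha.trans (List.prefix_append _ _)
  have h2 : p ++ [b] <+: u ++ z' := hb.trans (List.prefix_append _ _)
  have h3 := (List.prefix_of_prefix_length_le h1 h2 (by simp)).eq_of_length (by simp)
  simp at h3
  exact hab h3

lemma phi_injective (L : Level X v u s p) : Function.Injective (phi v u) := by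
  intro c
  induction c with
  | nil =>
    intro c' h
    by_contra hne
    have := L.phi_pos (Ne.symm hne)
    rw [← h] at this
    simp at this
  | cons y c ih =>
    intro c' h
    cases c' with
    | nil =>
      have := L.phi_pos (c := y :: c) (by simp)
      rw [h] at this
      simp at this
    | cons y' c' =>
      cases y <;> cases y' <;> simp only [phi_cons_false, phi_cons_true] at h
      · rw [ih (List.append_cancel_left h)]
      · exact absurd h (L.append_ne _ _)
      · exact absurd h.symm (L.append_ne _ _)
      · rw [ih (List.append_cancel_left h)]

/-- The codes have one and two letters 1, and `phi v u` is injective. This makes the two forms of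
the recursion exclusive. -/
lemma wpow_append_ne (L : Level X v u s p) (a b c : ℕ) :
    wpow v a ++ u ≠ wpow v b ++ u ++ wpow v c ++ u := by
  intro h
  have h1 : phi v u (zeros a ++ [true]) = phi v u (zeros b ++ true :: (zeros c ++ [true])) := by
    simpa [phi_replicate_false] using h
  have h2 := congrArg (List.count true) (L.phi_injective h1)
  simp [zeros, List.count_replicate] at h2

lemma s_suffix_wpow (L : Level X v u s p) (n : ℕ) : s <:+ s ++ wpow v n := by
  rw [← phi_replicate_false v u]
  exact L.s_suffix _

/-- Since `s` is a suffix of s v^n, it is a suffix of v^n for n ≥ |s|. Hence s v and s u are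
suffixes of v^∞ and v^∞ u, where the letters in front of the last `s` differ. -/
lemma isMaxCommonSuffix (L : Level X v u s p) : IsMaxCommonSuffix v u s := by
  have hpow : ∀ n, s.length ≤ n → s <:+ wpow v n := by
    intro n hn
    refine List.suffix_of_suffix_length_le (L.s_suffix_wpow n) (List.suffix_append _ _) ?_
    rw [length_wpow]
    exact hn.trans (Nat.le_mul_of_pos_right _ L.length_pos)
  have hmono : ∀ {m n : ℕ} {w t : List A}, m ≤ n → w <:+ wpow v m ++ t → w <:+ wpow v n ++ t := by
    intro m n w t hmn h
    obtain ⟨k, rfl⟩ := Nat.exists_eq_add_of_le hmn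
    rw [add_comm, wpow_add, List.append_assoc]
    exact h.trans (List.suffix_append _ _)
  have hv : s ++ v <:+ wpow v (s.length + 1) ++ [] := by
    rw [wpow_add, wpow_one, List.append_nil]
    exact (List.suffix_append_self_iff (l₃ := v)).2 (hpow _ le_rfl)
  have hu : s ++ u <:+ wpow v s.length ++ u :=
    (List.suffix_append_self_iff (l₃ := u)).2 (hpow _ le_rfl)
  refine ⟨⟨_, L.s_suffix_v.trans hv⟩, ⟨_, L.s_suffix_u.trans hu⟩, ?_⟩
  rintro w ⟨m, hm⟩ ⟨n, hn⟩
  set k := max (max m n) (s.length + 1)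
  have hk1 := hmono (show m ≤ k by omega) hm
  have hk2 := hmono (show n ≤ k by omega) hn
  have hv' := hmono (show s.length + 1 ≤ k by omega) hv
  have hu' := hmono (show s.length ≤ k by omega) hu
  rcases le_or_gt w.length s.length with h | h
  · exact List.suffix_of_suffix_length_le hk1 (L.s_suffix_v.trans hv') h
  · exfalso
    obtain ⟨c, d, hcd, hc, hd⟩ := L.left
    have h1 := List.suffix_of_suffix_length_le (hc.trans hv') hk1 (by simpa using h)
    have h2 := List.suffix_of_suffix_length_le (hd.trans hu') hk2 (by simpa using h)
    have h3 := (List.suffix_of_suffix_length_le h1 h2 (by simp)).eq_of_length (by simp)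
    simp at h3
    exact hcd h3

lemma phi_singleton_eq_or (v u : List A) (y : Bool) : phi v u [y] = v ∨ phi v u [y] = u := by
  cases y <;> simp

/-- Enough words to the left of a boundary spell some `phi v u c` of length at least |s|, which
therefore ends with `s`; the word to the right starts with `p`. -/
lemma cut_of_isDecomposition (L : Level X v u s p) {x : ℤ → A} {d : (ℤ → ℤ) × (ℤ → List A)}
    (hd : IsDecomposition v u x d) (i : ℤ) : Cut s p x (d.1 i) := by
  have hpast : ∀ n : ℕ, ∃ c : List Bool, n ≤ (phi v u c).length ∧
      d.1 (i - n) + (phi v u c).length = d.1 i ∧ At x (d.1 (i - n)) (phi v u c) := by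
    intro n
    induction n with
    | zero => exact ⟨[], by simp⟩
    | succ n ih =>
      obtain ⟨c, h1, h2, h3⟩ := ih
      obtain ⟨h4, h5, h6⟩ := hd.2.2 (i - (n + 1 : ℕ))
      rw [show i - ((n + 1 : ℕ) : ℤ) + 1 = i - n by push_cast; ring] at h5
      obtain ⟨y, hy⟩ : ∃ y, d.2 (i - (n + 1 : ℕ)) = phi v u [y] := by
        rcases h4 with h4 | h4
        · exact ⟨false, by simpa using h4⟩
        · exact ⟨true, by simpa using h4⟩
      rw [hy] at h5 h6
      have hpos := L.length_phi_singleton_pos y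
      refine ⟨[y] ++ c, ?_, ?_, ?_⟩
      · rw [phi_append, List.length_append]; omega
      · rw [phi_append, List.length_append]; push_cast at h5 ⊢; omega
      · rw [phi_append, at_append]
        exact ⟨h6, h5 ▸ h3⟩
  obtain ⟨c, h1, h2, h3⟩ := hpast s.length
  have h4 : s <:+ phi v u c :=
    List.suffix_of_suffix_length_le (L.s_suffix c) (List.suffix_append _ _) h1
  refine cut_iff.2 ⟨h3.of_suffix h4 (by omega), ?_⟩
  obtain ⟨h5, -, h6⟩ := hd.2.2 i
  have h6 : At x (d.1 i) (d.2 i) := h6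
  rcases h5 with h5 | h5
  · exact (h5 ▸ h6).of_prefix L.p_prefix_v
  · exact (h5 ▸ h6).of_prefix L.p_prefix_u

lemma isDecomposition_no_cut (L : Level X v u s p) {x : ℤ → A} (hx : x ∈ X)
    {d : (ℤ → ℤ) × (ℤ → List A)} (hd : IsDecomposition v u x d) (i : ℤ) :
    d.1 i < d.1 (i + 1) ∧ ∀ j, d.1 i < j → j < d.1 (i + 1) → ¬ Cut s p x j := by
  obtain ⟨h1, h2, h3⟩ := hd.2.2 i
  have h3 : At x (d.1 i) (d.2 i) := h3
  have hV := L.length_pos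
  have hU := L.len
  rw [h2]
  rcases L.next x hx _ (L.cut_of_isDecomposition hd i) with ⟨h4, -, h5⟩ | ⟨h4, -, h5⟩
  · rcases h1 with h1 | h1 <;> rw [h1] at h3 ⊢
    · exact ⟨by omega, h5⟩
    · exact (L.not_at_both h4 h3).elim
  · rcases h1 with h1 | h1 <;> rw [h1] at h3 ⊢
    · exact (L.not_at_both h3 h4).elim
    · exact ⟨by omega, h5⟩

lemma isDecomposition_unique (L : Level X v u s p) {x : ℤ → A} (hx : x ∈ X)
    {d d' : (ℤ → ℤ) × (ℤ → List A)} (hd : IsDecomposition v u x d)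
    (hd' : IsDecomposition v u x d') : d = d' := by
  have hsame : ∀ i, d.1 i = d'.1 i → d.2 i = d'.2 i := by
    intro i hi
    obtain ⟨h1, -, h2⟩ := hd.2.2 i
    obtain ⟨h3, -, h4⟩ := hd'.2.2 i
    have h2 : At x (d.1 i) (d.2 i) := h2
    have h4 : At x (d'.1 i) (d'.2 i) := h4
    rw [← hi] at h4
    rcases h1 with h1 | h1 <;> rcases h3 with h3 | h3 <;> rw [h1] at h2 ⊢ <;> rw [h3] at h4 ⊢
    · exact (L.not_at_both h2 h4).elim
    · exact (L.not_at_both h4 h2).elim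
  have hle : ∀ {d d' : (ℤ → ℤ) × (ℤ → List A)}, IsDecomposition v u x d →
      IsDecomposition v u x d' → ∀ i, d'.1 i < d.1 (i + 1) → d'.1 i ≤ d.1 i := by
    intro d d' hd hd' i h
    by_contra! hlt
    exact (L.isDecomposition_no_cut hx hd i).2 _ hlt h (L.cut_of_isDecomposition hd' i)
  have h0 : d.1 0 = d'.1 0 := by
    refine le_antisymm (hle hd' hd 0 ?_) (hle hd hd' 0 ?_)
    · exact hd.1.trans_lt hd'.2.1
    · exact hd'.1.trans_lt hd.2.1
  have h1 : ∀ i, d.1 i = d'.1 i := by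
    intro i
    induction i using Int.induction_on with
    | zero => exact h0
    | succ i ih => rw [(hd.2.2 _).2.1, (hd'.2.2 _).2.1, ih, hsame _ ih]
    | pred i ih =>
      have e : -(i : ℤ) = (-i - 1) + 1 := by ring
      have l1 := (L.isDecomposition_no_cut hx hd (-i - 1)).1
      have l2 := (L.isDecomposition_no_cut hx hd' (-i - 1)).1
      rw [← e] at l1 l2
      refine le_antisymm (hle hd' hd _ ?_) (hle hd hd' _ ?_)
      · rw [← e]; omega
      · rw [← e]; omega
  exact Prod.ext (funext h1) (funext fun i => hsame i (h1 i))

lemma exists_isDecomposition (L : Level X v u s p) (hX : MinimalAperiodic X) {x : ℤ → A}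
    (hx : x ∈ X) : ∃ d, IsDecomposition v u x d := by
  have hnext := fun c : {i // Cut s p x i} => L.next_cat hx c.2
  choose y hy hno using hnext
  have hcut : ∀ c : {i // Cut s p x i}, Cut s p x (c + (phi v u [y c]).length) := fun c =>
    cat_nil.1 (L.cat_append.1 (by simpa using hy c : CAt v u s p x c ([y c] ++ []))).2
  -- Passing to the next cut is a permutation of the cuts; its integer powers, applied to the last
  -- cut at or before 0, number the decomposition.
  let f : {i // Cut s p x i} → {i // Cut s p x i} := fun c => ⟨_, hcut c⟩
  have hlt : ∀ c : {i // Cut s p x i}, (c : ℤ) < f c := by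
    intro c
    have := L.length_phi_singleton_pos (y c)
    simp only [f]
    omega
  have hf : Function.Bijective f := by
    constructor
    · have key : ∀ c c', f c = f c' → (c : ℤ) ≤ c' := by
        intro c c' h
        by_contra! hc
        refine hno c' c hc ?_ c.2
        have h1 := hlt c
        rw [h] at h1
        exact h1
      exact fun c c' h => Subtype.ext (le_antisymm (key c c' h) (key c' c h.symm))
    · intro c
      obtain ⟨j, hj, hjc, hlast⟩ := L.exists_last_cut hX hx (c - 1)
      refine ⟨⟨j, hjc⟩, Subtype.ext ?_⟩
      rcases lt_trichotomy (f ⟨j, hjc⟩ : ℤ) c with h | h | h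
      · exact absurd (f ⟨j, hjc⟩).2 (hlast _ (hlt ⟨j, hjc⟩) (by omega))
      · exact h
      · exact absurd c.2 (hno ⟨j, hjc⟩ c (by simp only; omega) h)
  let e : Equiv.Perm {i // Cut s p x i} := Equiv.ofBijective f hf
  obtain ⟨j, hj, hjc, hlast⟩ := L.exists_last_cut hX hx 0
  have hsucc : ∀ i : ℤ, (e ^ (i + 1)) ⟨j, hjc⟩ = f ((e ^ i) ⟨j, hjc⟩) := by
    intro i
    rw [add_comm, zpow_one_add]
    rfl
  refine ⟨⟨fun i => (e ^ i) ⟨j, hjc⟩, fun i => phi v u [y ((e ^ i) ⟨j, hjc⟩)]⟩, ?_, ?_, ?_⟩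
  · simpa using hj
  · have h1 : (e ^ (1 : ℤ)) ⟨j, hjc⟩ = f ⟨j, hjc⟩ := by simpa using hsucc 0
    simp only [h1]
    by_contra! hle
    exact hlast _ (hlt ⟨j, hjc⟩) hle (f ⟨j, hjc⟩).2
  · intro i
    refine ⟨phi_singleton_eq_or _ _ _, ?_, ?_⟩
    · simp only [hsucc i]
      rfl
    · exact (at_append.1 (cat_iff.1 (hy ((e ^ i) ⟨j, hjc⟩))).2).1

lemma existsUnique_isDecomposition (L : Level X v u s p) (hX : MinimalAperiodic X) {x : ℤ → A}
    (hx : x ∈ X) : ∃! d : (ℤ → ℤ) × (ℤ → List A), IsDecomposition v u x d := by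
  obtain ⟨d, hd⟩ := L.exists_isDecomposition hX hx
  exact ⟨d, hd, fun d' hd' => L.isDecomposition_unique hx hd' hd⟩

lemma u_mem_lang (L : Level X v u s p) (hX : MinimalAperiodic X) : u ∈ Lang X := by
  obtain ⟨g, hg⟩ := L.exists_gap hX
  have h1 : [true] ∈ CLang X v u s p := L.cLang_infix hg ⟨[], zeros g ++ [true], by simp⟩
  exact lang_of_infix h1 ⟨s, p, by simp⟩

lemma v_mem_lang (L : Level X v u s p) (hX : MinimalAperiodic X) : v ∈ Lang X :=
  lang_of_infix (L.u_mem_lang hX) L.suf.isInfix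

end Level

/-- One step of the recursion, with the parameters `m`, `n`, `r`. -/
structure IsStep (v u s p v' u' s' p' : List A) (m n r : ℕ) : Prop where
  lt_m : r < m
  lt_n : m < n
  v_eq : v' = wpow v (m - 1) ++ u ++ if r = 0 then [] else wpow v (r - 1) ++ u
  u_eq : u' = wpow v (n - 1) ++ u ++ if r = 0 then [] else wpow v (r - 1) ++ u
  s_eq : s' = s ++ v'
  p_eq : p' = wpow v (m - 1) ++ p

lemma Level.exists_step [Finite A] (L : Level X v u s p) (hX : MinimalAperiodic X)
    (hq : ∀ q, v.length ≤ q → 2 * complexity X q < 3 * q) :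
    ∃ v' u' s' p' m n r, Level X v' u' s' p' ∧ IsStep v u s p v' u' s' p' m n r := by
  obtain ⟨g, h, t, hgh, ht, L'⟩ := L.exists_next_level hX hq
  rcases ht with rfl | ⟨r, hr, rfl⟩
  -- The parameters exceed the numbers of zeros by one, which leaves r = 0 free to encode an empty
  -- t.
  · exact ⟨_, _, _, _, g + 1, h + 1, 0, L', by omega, by omega,
      by simp [phi_replicate_false], by simp [phi_replicate_false], rfl,
      by simp [phi_replicate_false]⟩
  · exact ⟨_, _, _, _, g + 1, h + 1, r + 1, L', by omega, by omega,
      by simp [phi_replicate_false], by simp [phi_replicate_false], rfl,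
      by simp [phi_replicate_false]⟩

lemma IsStep.length_v_lt (L : Level X v u s p) {v' u' s' p' : List A} {m n r : ℕ}
    (h : IsStep v u s p v' u' s' p' m n r) : v.length < v'.length := by
  have := L.len
  rw [h.v_eq]
  simp only [List.length_append]
  omega

lemma IsStep.length_bound (L : Level X v u s p) {v' u' s' p' : List A} {m n r : ℕ}
    (h : IsStep v u s p v' u' s' p' m n r) :
    p'.length + s'.length < 2 * v'.length + v.length := by
  have h1 := L.short
  have h2 : (m - 1) * v.length + u.length ≤ v'.length := by
    rw [h.v_eq]
    simp only [List.length_append, length_wpow]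
    omega
  rw [h.p_eq, h.s_eq]
  simp only [List.length_append, length_wpow]
  omega

lemma IsStep.xor (L : Level X v u s p) {v' u' s' p' : List A} {m n r : ℕ}
    (h : IsStep v u s p v' u' s' p' m n r) :
    Xor (∃ m n : ℕ, 0 < m ∧ m < n ∧ v' = wpow v (m - 1) ++ u ∧ u' = wpow v (n - 1) ++ u)
      (∃ r m n : ℕ, 0 < r ∧ r < m ∧ m < n ∧
        v' = wpow v (m - 1) ++ u ++ wpow v (r - 1) ++ u ∧
        u' = wpow v (n - 1) ++ u ++ wpow v (r - 1) ++ u) := by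
  have h1 := h.lt_m
  have h2 := h.lt_n
  have h3 := h.v_eq
  have h4 := h.u_eq
  rcases Nat.eq_zero_or_pos r with rfl | hr
  · refine Or.inl ⟨⟨m, n, h1, h2, by simpa using h3, by simpa using h4⟩, ?_⟩
    rintro ⟨r', m', n', -, -, -, h5, -⟩
    exact L.wpow_append_ne (m - 1) (m' - 1) (r' - 1) (by rw [← h5]; simpa using h3.symm)
  · rw [if_neg hr.ne'] at h3 h4
    refine Or.inr ⟨⟨r, m, n, hr, h1, h2, by simpa using h3, by simpa using h4⟩, ?_⟩
    rintro ⟨m', n', -, -, h5, -⟩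
    exact L.wpow_append_ne (m' - 1) (m - 1) (r - 1) (by rw [← h5]; simpa using h3)

end Words

/-! ### One-sided limits and their orbit closures -/

section Limits

variable {A : Type*}

lemma rightBlock_add (y : ℕ → A) (i m n : ℕ) :
    rightBlock y i (m + n) = rightBlock y i m ++ rightBlock y (i + m) n := by
  unfold rightBlock
  rw [List.ofFn_add]
  simp [add_assoc]

@[simp] lemma length_rightBlock (y : ℕ → A) (i n : ℕ) : (rightBlock y i n).length = n := by
  simp [rightBlock]

lemma leftBlock_eq (z : ℕ → A) (i n : ℕ) : leftBlock z i n = (rightBlock z i n).reverse := rfl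

lemma rightBlock_prefix (y : ℕ → A) (i : ℕ) {m n : ℕ} (h : m ≤ n) :
    rightBlock y i m <+: rightBlock y i n := by
  obtain ⟨k, rfl⟩ := Nat.exists_eq_add_of_le h
  rw [rightBlock_add]
  exact List.prefix_append _ _

lemma eq_rightBlock_of_infix {y : ℕ → A} {M : ℕ} {w : List A} (h : w <:+: rightBlock y 0 M) :
    ∃ j, w = rightBlock y j w.length := by
  obtain ⟨a, b, h⟩ := h
  have hM : M = a.length + w.length + b.length := by
    simpa [add_assoc] using (congrArg List.length h).symm
  subst hM
  rw [rightBlock_add, rightBlock_add] at h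
  have h1 := (List.append_inj h (by simp)).1
  exact ⟨_, (List.append_inj h1 (by simp)).2⟩

/-- The limit of a sequence of words each of which is a prefix of the next one. -/
lemma exists_prefix_limit {w : ℕ → List A} (hw : ∀ k, w k <+: w (k + 1))
    (hlen : ∀ N, ∃ k, N ≤ (w k).length) : ∃ y : ℕ → A, ∀ k, rightBlock y 0 (w k).length = w k := by
  have hmono : ∀ k l, k ≤ l → w k <+: w l := fun k l hkl =>
    Nat.le_induction (List.prefix_refl _) (fun l _ ih => ih.trans (hw l)) l hkl
  choose K hK using fun n => hlen (n + 1)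
  refine ⟨fun n => (w (K n))[n]'(hK n), fun k => ?_⟩
  apply List.ext_getElem (by simp)
  intro n h1 h2
  simp only [rightBlock, List.getElem_ofFn, zero_add]
  have h3 : n < (w (K n)).length := hK n
  rcases le_total k (K n) with h | h
  · exact ((hmono _ _ h).getElem h2).symm
  · exact (hmono _ _ h).getElem h3

lemma MinimalAperiodic.infix_of_long {X : Set (ℤ → A)} (hX : MinimalAperiodic X) {w : List A}
    (hw : w ∈ Lang X) : ∃ M, ∀ z ∈ Lang X, M ≤ z.length → w <:+: z := by
  obtain ⟨N, hN⟩ := hX.recurrent w hw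
  refine ⟨N + w.length, ?_⟩
  rintro z ⟨x, hx, i, hi⟩ hz
  obtain ⟨j, h1, h2, h3⟩ := hN x hx i
  have h4 := block_infix_block (x := x) (i := i) (j := j) (m := w.length) (n := z.length) h1
    (by omega)
  unfold At at hi h3
  rwa [h3, hi] at h4

variable [TopologicalSpace A]

/-- By recurrence each word of X occurs in every long word of X, in particular in the prefixes of
`y`; conversely X is determined by its language. -/
lemma eq_rightOrbitClosure (X : Subshift A ℤ) (hX : MinimalAperiodic X.carrier) {y : ℕ → A}
    (hy : ∀ N, rightBlock y 0 N ∈ Lang X.carrier) : X.carrier = rightOrbitClosure y := by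
  ext x
  constructor
  · intro hx i N
    obtain ⟨M, hM⟩ := hX.infix_of_long (w := block x i N) ⟨x, hx, i, by simp⟩
    obtain ⟨j, hj⟩ := eq_rightBlock_of_infix (hM _ (hy M) (by simp))
    exact ⟨j, by simpa using hj⟩
  · intro hx
    refine mem_of_blocks_mem_lang X fun i N => ?_
    obtain ⟨j, hj⟩ := hx i N
    rw [hj]
    refine lang_of_infix (hy (j + N)) ?_
    rw [rightBlock_add, zero_add]
    exact (List.suffix_append _ _).isInfix

lemma eq_leftOrbitClosure (X : Subshift A ℤ) (hX : MinimalAperiodic X.carrier) {z : ℕ → A}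
    (hz : ∀ N, leftBlock z 0 N ∈ Lang X.carrier) : X.carrier = leftOrbitClosure z := by
  ext x
  constructor
  · intro hx i N
    obtain ⟨M, hM⟩ := hX.infix_of_long (w := block x i N) ⟨x, hx, i, by simp⟩
    have h1 := hM _ (hz M) (by simp [leftBlock_eq])
    rw [leftBlock_eq, ← List.reverse_infix, List.reverse_reverse] at h1
    obtain ⟨j, hj⟩ := eq_rightBlock_of_infix h1
    refine ⟨j, ?_⟩
    rw [leftBlock_eq, ← List.reverse_eq_iff]
    simpa using hj
  · intro hx
    refine mem_of_blocks_mem_lang X fun i N => ?_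
    obtain ⟨j, hj⟩ := hx i N
    rw [hj]
    refine lang_of_infix (hz (j + N)) ?_
    rw [leftBlock_eq, leftBlock_eq, List.reverse_infix, rightBlock_add, zero_add]
    exact (List.suffix_append _ _).isInfix

end Limits

/-! ### The substitutions as recursion steps -/

section Adic

variable {A : Type*}

lemma flatMap_replicate_zero (θ : Fin 2 → List A) (n : ℕ) :
    (List.replicate n (0 : Fin 2)).flatMap θ = wpow (θ 0) n := by
  simp [wpow, List.flatMap_replicate]

lemma substComp_tau_zero (θ : Fin 2 → List A) (m n r : ℕ) :
    substComp θ (tau m n r) 0 =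
      wpow (θ 0) (m - 1) ++ θ 1 ++ if r = 0 then [] else wpow (θ 0) (r - 1) ++ θ 1 := by
  by_cases hr : r = 0 <;>
    simp only [substComp, tau, hr, if_true, if_false, List.flatMap_append, flatMap_replicate_zero,
      List.flatMap_singleton, List.flatMap_nil, List.replicate_zero, List.nil_append]

lemma substComp_tau_one (θ : Fin 2 → List A) {m n : ℕ} (r : ℕ) (hm : 0 < m) (hmn : m < n) :
    substComp θ (tau m n r) 1 =
      wpow (θ 0) (n - 1) ++ θ 1 ++ if r = 0 then [] else wpow (θ 0) (r - 1) ++ θ 1 := by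
  have h : wpow (θ 0) (n - 1) = wpow (θ 0) (n - m) ++ wpow (θ 0) (m - 1) := by
    rw [← wpow_add]; congr 1; omega
  rw [h]
  by_cases hr : r = 0 <;>
    simp only [substComp, tau, hr, if_true, if_false, List.flatMap_append, flatMap_replicate_zero,
      List.flatMap_singleton, List.flatMap_nil, Fin.one_eq_zero_iff, OfNat.ofNat_ne_one]

end Adic

/-! ### The sequence of levels and its limits -/

section Sequence

variable {A : Type*} {X : Set (ℤ → A)}

lemma exists_complexity_bound {X : Set (ℤ → A)}
    (hlim : limsup (fun q : ℕ => (((complexity X q : ℝ) / (q : ℝ) : ℝ) : EReal)) atTop <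
      ((3 / 2 : ℝ) : EReal)) :
    ∃ ν : ℝ, 0 < ν ∧ ∃ q₀ : ℕ, ∀ q, q₀ ≤ q → (complexity X q : ℝ) < (3 / 2 - ν) * q := by
  obtain ⟨c, hc, hc'⟩ := EReal.lt_iff_exists_real_btwn.1 hlim
  have h1 := eventually_lt_of_limsup_lt hc
  obtain ⟨q₀, hq₀⟩ := eventually_atTop.1 h1
  refine ⟨3 / 2 - c, sub_pos.2 (EReal.coe_lt_coe_iff.1 hc'), max q₀ 1, fun q hq => ?_⟩
  have h2 := EReal.coe_lt_coe_iff.1 (hq₀ q (le_of_max_le_left hq))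
  have h3 : (0 : ℝ) < q := by exact_mod_cast le_of_max_le_right hq
  rw [div_lt_iff₀ h3] at h2
  linarith

lemma exists_level_sequence [Finite A] (hX : MinimalAperiodic X) {q₀ : ℕ}
    (hq : ∀ q, q₀ ≤ q → 2 * complexity X q < 3 * q) :
    ∃ (v u s p : ℕ → List A) (m n r : ℕ → ℕ), q₀ ≤ (v 0).length ∧
      (∀ k, Level X (v k) (u k) (s k) (p k)) ∧
      ∀ k, IsStep (v k) (u k) (s k) (p k) (v (k + 1)) (u (k + 1)) (s (k + 1)) (p (k + 1))
        (m k) (n k) (r k) := by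
  -- The bound q₀ ≤ |v| is carried along, since it makes the complexity estimate available at each
  -- step.
  let S := {w : List A × List A × List A × List A //
    Level X w.1 w.2.1 w.2.2.1 w.2.2.2 ∧ q₀ ≤ w.1.length}
  have hstep : ∀ w : S, ∃ w' : S, ∃ m n r : ℕ, IsStep w.1.1 w.1.2.1 w.1.2.2.1 w.1.2.2.2
      w'.1.1 w'.1.2.1 w'.1.2.2.1 w'.1.2.2.2 m n r := by
    rintro ⟨⟨v, u, s, p⟩, L, hl⟩
    obtain ⟨v', u', s', p', m, n, r, L', h⟩ := L.exists_step hX fun q h => hq q (hl.trans h)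
    exact ⟨⟨⟨v', u', s', p'⟩, L', hl.trans (h.length_v_lt L).le⟩, m, n, r, h⟩
  choose f m n r hf using hstep
  obtain ⟨v₀, u₀, s₀, L₀, hl₀⟩ := exists_initial_level hX hq q₀
  let w : ℕ → S := fun k => f^[k] ⟨⟨v₀, u₀, s₀, []⟩, L₀, hl₀⟩
  have hw : ∀ k, w (k + 1) = f (w k) := fun k => Function.iterate_succ_apply' f k _
  refine ⟨fun k => (w k).1.1, fun k => (w k).1.2.1, fun k => (w k).1.2.2.1,
    fun k => (w k).1.2.2.2, fun k => m (w k), fun k => n (w k), fun k => r (w k), hl₀,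
    fun k => (w k).2.1, fun k => ?_⟩
  simp only [hw]
  exact hf (w k)

variable {v u s p : ℕ → List A} {m n r : ℕ → ℕ}

lemma xi_eq (hS : ∀ k, IsStep (v k) (u k) (s k) (p k) (v (k + 1)) (u (k + 1)) (s (k + 1))
      (p (k + 1)) (m k) (n k) (r k)) (k : ℕ) :
    xi ![v 0, u 0] m n r k 0 = v k ∧ xi ![v 0, u 0] m n r k 1 = u k := by
  induction k with
  | zero => exact ⟨rfl, rfl⟩
  | succ k ih =>
    have h := hS k
    have h1 := h.lt_m
    refine ⟨?_, ?_⟩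
    · rw [xi, substComp_tau_zero, ih.1, ih.2, h.v_eq]
    · rw [xi, substComp_tau_one _ _ (by omega) h.lt_n, ih.1, ih.2, h.u_eq]

/-- Here m = 1 forces r = 0, so v_{k+2} = u_{k+1}, which starts with v_k because n_k ≥ 2. -/
lemma v_prefix_add_two (hS : ∀ k, IsStep (v k) (u k) (s k) (p k) (v (k + 1)) (u (k + 1))
      (s (k + 1)) (p (k + 1)) (m k) (n k) (r k)) {k : ℕ} (h : m k = 1) (h' : m (k + 1) = 1) : v k <+: v (k + 2) := by
  have s0 := hS k
  have s1 := hS (k + 1)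
  have r0 := s0.lt_m
  have r1 := s1.lt_m
  have n0 := s0.lt_n
  have e1 : v (k + 2) = u (k + 1) := by
    rw [s1.v_eq, h', show r (k + 1) = 0 by omega]; simp [wpow]
  rw [e1, s0.u_eq, show n k - 1 = 1 + (n k - 2) by omega, wpow_add, wpow_one]
  simp only [List.append_assoc]
  exact List.prefix_append _ _

section Chains

variable (hL : ∀ k, Level X (v k) (u k) (s k) (p k))
  (hS : ∀ k, IsStep (v k) (u k) (s k) (p k) (v (k + 1)) (u (k + 1)) (s (k + 1))
    (p (k + 1)) (m k) (n k) (r k))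

include hL hS

lemma le_length_v (k : ℕ) : k ≤ (v k).length := by
  induction k with
  | zero => simp
  | succ k ih => exact Nat.succ_le_of_lt (ih.trans_lt ((hS k).length_v_lt (hL k)))

lemma v_suffix (k : ℕ) : v k <:+ v (k + 1) := by
  rw [(hS k).v_eq]
  split_ifs
  · rw [List.append_nil]
    exact (hL k).suf.trans (List.suffix_append _ _)
  · rw [← List.append_assoc]
    exact (hL k).suf.trans (List.suffix_append _ _)

lemma p_prefix_succ (k : ℕ) : p k <+: p (k + 1) := by
  rw [(hS k).p_eq, ← phi_replicate_false (v k) (u k)]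
  exact (hL k).p_prefix _

lemma p_prefix_of_le {k l : ℕ} (h : k ≤ l) : p k <+: p l :=
  Nat.le_induction (List.prefix_refl _) (fun l _ ih => ih.trans (p_prefix_succ hL hS l)) l h

lemma le_length_p_succ {k : ℕ} (h : 2 ≤ m k) : k ≤ (p (k + 1)).length := by
  rw [(hS k).p_eq, List.length_append, length_wpow]
  have h1 := le_length_v hL hS k
  have h2 := Nat.le_mul_of_pos_left (v k).length (show 0 < m k - 1 by omega)
  omega

variable (hX : MinimalAperiodic X)

include hX

lemma exists_left_limit : ∃ z : ℕ → A, IsLeftLimit v z ∧ ∀ N, leftBlock z 0 N ∈ Lang X := by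
  obtain ⟨z, hz⟩ := exists_prefix_limit (w := fun k => (v k).reverse)
    (fun k => List.reverse_prefix.2 (v_suffix hL hS k))
    (fun N => ⟨N, by simpa using le_length_v hL hS N⟩)
  have key : ∀ N k, N ≤ k → leftBlock z 0 N <:+ v k := by
    intro N k hk
    rw [leftBlock_eq, ← List.reverse_prefix, List.reverse_reverse, ← hz k]
    exact rightBlock_prefix _ _ (by simpa using hk.trans (le_length_v hL hS k))
  exact ⟨z, fun N => eventually_atTop.2 ⟨N, key N⟩,
    fun N => lang_of_infix ((hL N).v_mem_lang hX) (key N N le_rfl).isInfix⟩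

lemma exists_right_limit : ∃ y : ℕ → A, IsRightSubseqLimit v y ∧
    ((∃ᶠ k in atTop, 2 ≤ m k) → IsRightLimit v y) ∧ ∀ N, rightBlock y 0 N ∈ Lang X := by
  suffices h : ∃ y : ℕ → A, IsRightSubseqLimit v y ∧
      ((∃ᶠ k in atTop, 2 ≤ m k) → IsRightLimit v y) by
    obtain ⟨y, h1, h2⟩ := h
    refine ⟨y, h1, h2, fun N => ?_⟩
    obtain ⟨k, hk⟩ := (h1 N).exists
    exact lang_of_infix ((hL k).v_mem_lang hX) hk.isInfix
  -- If m ≥ 2 infinitely often, the nested prefixes p_k of v_k become arbitrarily long and define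
  -- `y`. Otherwise m = 1 from some `K` on, and every second v_k gives a nested sequence.
  by_cases hm : ∃ᶠ k in atTop, 2 ≤ m k
  · have hlen : ∀ N, ∃ k, N ≤ (p k).length := by
      intro N
      obtain ⟨k, hk, h2⟩ := frequently_atTop.1 hm N
      exact ⟨k + 1, hk.trans (le_length_p_succ hL hS h2)⟩
    obtain ⟨y, hy⟩ := exists_prefix_limit (p_prefix_succ hL hS) hlen
    have hlim : IsRightLimit v y := by
      intro N
      obtain ⟨K, hK⟩ := hlen N
      filter_upwards [eventually_ge_atTop K] with k hk
      have h1 : rightBlock y 0 N <+: p K := hy K ▸ rightBlock_prefix _ _ hK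
      exact (h1.trans (p_prefix_of_le hL hS hk)).trans (hL k).p_prefix_v
    exact ⟨y, fun N => (hlim N).frequently, fun _ => hlim⟩
  · obtain ⟨K, hK⟩ := eventually_atTop.1 (not_frequently.1 hm)
    have hm1 : ∀ k, K ≤ k → m k = 1 := by
      intro k hk
      have h1 := (hS k).lt_m
      have h2 := hK k hk
      omega
    have hlen : ∀ j, j ≤ (v (K + 2 * j)).length := fun j =>
      (show j ≤ K + 2 * j by omega).trans (le_length_v hL hS _)
    obtain ⟨y, hy⟩ := exists_prefix_limit (w := fun j => v (K + 2 * j))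
      (fun j => v_prefix_add_two hS (hm1 _ (by omega)) (hm1 _ (by omega)))
      (fun N => ⟨N, hlen N⟩)
    refine ⟨y, fun N => frequently_atTop.2 fun a => ?_, fun h => absurd h hm⟩
    refine ⟨K + 2 * (N + a), by omega, ?_⟩
    rw [← hy (N + a)]
    exact rightBlock_prefix _ _ ((show N ≤ N + a by omega).trans (hlen (N + a)))

end Chains

end Sequence

end LowComplexity

/-! ### Assembly of the theorem -/

theorem proposition3p1 {A : Type*} [Fintype A] [TopologicalSpace A] [DiscreteTopology A]
    (X : SymbolicDynamics.FullShift.Subshift A ℤ)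
    (hinf : X.carrier.Infinite)
    (hmin : LowComplexity.IsMinimalSubshift X)
    (hlim : Filter.limsup
      (fun q : ℕ => (((LowComplexity.complexity X.carrier q : ℝ) / (q : ℝ) : ℝ) : EReal))
      Filter.atTop < ((3 / 2 : ℝ) : EReal)) :
    ∃ (ν : ℝ) (u v p s : ℕ → List A), 0 < ν ∧
      -- `p k` and `s k` are the maximal common prefix and suffix
      (∀ k, LowComplexity.IsMaxCommonPrefix (u k) (v k) (p k)) ∧
      (∀ k, LowComplexity.IsMaxCommonSuffix (v k) (u k) (s k)) ∧
      -- unique decomposition, lengths, and the complexity bound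
      (∀ k, ∀ x ∈ X.carrier, ∃! d : (ℤ → ℤ) × (ℤ → List A),
        LowComplexity.IsDecomposition (v k) (u k) x d) ∧
      (∀ k, 0 < (v k).length ∧ (v k).length < (u k).length ∧ v k <:+ u k) ∧
      (∀ k, (p k).length + (s k).length < (v k).length + (u k).length) ∧
      (∀ k, (p (k + 1)).length + (s (k + 1)).length < 2 * (v (k + 1)).length + (v k).length ∧
        2 * (v (k + 1)).length + (v k).length < 3 * (v (k + 1)).length) ∧
      (∀ q : ℕ, (v 0).length ≤ q →
        (LowComplexity.complexity X.carrier q : ℝ) < (3 / 2 - ν) * (q : ℝ)) ∧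
      -- the recursion: exactly one of the two forms at each step
      (∀ k, Xor
        (∃ m n : ℕ, 0 < m ∧ m < n ∧
          v (k + 1) = LowComplexity.wpow (v k) (m - 1) ++ u k ∧
          u (k + 1) = LowComplexity.wpow (v k) (n - 1) ++ u k)
        (∃ r m n : ℕ, 0 < r ∧ r < m ∧ m < n ∧
          v (k + 1) = LowComplexity.wpow (v k) (m - 1) ++ u k ++
            LowComplexity.wpow (v k) (r - 1) ++ u k ∧
          u (k + 1) = LowComplexity.wpow (v k) (n - 1) ++ u k ++
            LowComplexity.wpow (v k) (r - 1) ++ u k)) ∧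
      -- the S-adic form
      ∃ (π : Fin 2 → List A) (m n r : ℕ → ℕ),
        (∀ k, r k < m k ∧ m k < n k) ∧
        (∀ k, v k = LowComplexity.xi π m n r k 0 ∧ u k = LowComplexity.xi π m n r k 1) ∧
        (∃ z : ℕ → A, LowComplexity.IsLeftLimit (fun k => LowComplexity.xi π m n r k 0) z ∧
          X.carrier = LowComplexity.leftOrbitClosure z) ∧
        (∃ y : ℕ → A,
          LowComplexity.IsRightSubseqLimit (fun k => LowComplexity.xi π m n r k 0) y ∧
          ((∃ᶠ k in Filter.atTop, 2 ≤ m k) →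
            LowComplexity.IsRightLimit (fun k => LowComplexity.xi π m n r k 0) y) ∧
          X.carrier = LowComplexity.rightOrbitClosure y) := by
  have hX := hmin.minimalAperiodic hinf
  obtain ⟨ν, hν, q₀, hq₀⟩ := LowComplexity.exists_complexity_bound hlim
  have hq : ∀ q, q₀ ≤ q → 2 * LowComplexity.complexity X.carrier q < 3 * q := by
    intro q hq
    have h1 := hq₀ q hq
    have h2 : (0 : ℝ) ≤ ν * q := by positivity
    have h3 : (2 * LowComplexity.complexity X.carrier q : ℝ) < 3 * q := by linarith
    exact_mod_cast h3
  obtain ⟨v, u, s, p, m, n, r, hl, hL, hS⟩ := LowComplexity.exists_level_sequence hX hq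
  have hxi := LowComplexity.xi_eq hS
  have hv : (fun k => LowComplexity.xi ![v 0, u 0] m n r k 0) = v := funext fun k => (hxi k).1
  obtain ⟨z, hz, hzL⟩ := LowComplexity.exists_left_limit hL hS hX
  obtain ⟨y, hy, hy', hyL⟩ := LowComplexity.exists_right_limit hL hS hX
  refine ⟨ν, u, v, p, s, hν, fun k => (hL k).isMaxCommonPrefix,
    fun k => (hL k).isMaxCommonSuffix, fun k x hx => (hL k).existsUnique_isDecomposition hX hx,
    fun k => ⟨(hL k).length_pos, (hL k).len, (hL k).suf⟩, fun k => (hL k).short, fun k => ?_,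
    fun q hq' => hq₀ q (hl.trans hq'), fun k => (hS k).xor (hL k),
    ![v 0, u 0], m, n, r, fun k => ⟨(hS k).lt_m, (hS k).lt_n⟩,
    fun k => ⟨(hxi k).1.symm, (hxi k).2.symm⟩, ?_, ?_⟩
  · refine ⟨(hS k).length_bound (hL k), ?_⟩
    have := (hS k).length_v_lt (hL k)
    omega
  · rw [hv]
    exact ⟨z, hz, LowComplexity.eq_leftOrbitClosure X hX hzL⟩
  · rw [hv]
    exact ⟨y, hy, hy', LowComplexity.eq_rightOrbitClosure X hX hyL⟩
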